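/- \textbf{Setting.} An instance consists of a finite ground set $U$, a monotone submodular function $f:2^U\to\mathbb{Z}_{\ge 0}$ with $Q:=f(U)$, and $m$ items; item $i$ has cost $c_i\ge 0$ and realizes to a random element $X_i\in U$, where $(X_1,\dots,X_m)$ has a given joint distribution $\mathcal D$ on $U^m$. A set $S$ of items covers $f$ if $f(\{X_i : i\in S\})=Q$; its cost is $c(S)=\sum_{i\in S}c_i$. The realization of an item becomes known only when the item is probed. We assume that probing all items covers $f$ with probability one. Let $\mathrm{OPT}$ be the least expected cost of a fully adaptive solution (each decision may depend on all realizations observed so far) that covers $f$ with probability one. A set-based $r$-round adaptive solution chooses in each round $k=1,\dots,r$ a set $S_k$ of items, as a function of the realizations observed in rounds $1,\dots,k-1$, probes all of $S_k$ in parallel and pays $c(S_k)$; it covers $f$ if $S_1\cup\dots\cup S_r$ does. Let $s=|\operatorname{supp}\mathcal D|$ be the number of scenarios. As usual, $\log 0$ is read as $0$. \textbf{Theorem.} There is an absolute constant $C>0$ such that for every such instance, every integer $r\ge 1$ and every real $\eta>0$: (1) (Stochastic submodular cover.) If the items $X_1,\dots,X_m$ are independent, then there is a set-based $r$-round adaptive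 solution that covers $f$ with probability at least $1-\eta$ and whose expected cost is at most $$C\cdot\frac{r}{\eta}\cdot\max\{1,\;Q^{1/r}\log Q\}\cdot \mathrm{OPT}.$$ (2) (Scenario submodular cover.) For an arbitrary joint distribution $\mathcal D$, there is a set-based $r$-round adaptive solution that covers $f$ with probability at least $1-\eta$ and whose expected cost is at most $$C\cdot\frac{r}{\eta}\cdot\max\{1,\;s^{1/r}\log s+r\log Q\}\cdot \mathrm{OPT}.$$ (The maximum with $1$ matters, up to the constant $C$, only in the degenerate cases where the logarithmic expression vanishes, namely $Q=1$ in (1) and $s=Q=1$ in (2), apart from the trivial case $Q=0$.) -/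

import Mathlib

universe u

/-- An instance of submodular cover with `m` stochastic items over the finite ground set `U`:
item costs, a monotone submodular function `f : 2^U → ℕ`, and the joint distribution `D` of the
realizations of the items (item `i` realizes to the element `X i` of `U`). -/
structure CoverInstance (U : Type u) [Fintype U] [DecidableEq U] (m : ℕ) where
  /-- cost of each item -/
  cost : Fin m → ℝ
  cost_nonneg : ∀ i, 0 ≤ cost i
  /-- the function to be covered -/
  f : Finset U → ℕ
  f_mono : ∀ A B : Finset U, A ⊆ B → f A ≤ f B
  f_submodular : ∀ A B : Finset U, f (A ∪ B) + f (A ∩ B) ≤ f A + f B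
  /-- joint distribution of the items -/
  D : PMF (Fin m → U)

/-- A fully adaptive solution, as a decision tree: it either ends, or probes an item and
continues depending on the realization that it observes. -/
inductive AdaptiveSolution (U : Type u) (m : ℕ) : Type u where
  | done : AdaptiveSolution U m
  | probe (i : Fin m) (next : U → AdaptiveSolution U m) : AdaptiveSolution U m

/-- The set of items probed by an adaptive solution when the items realize to `X`. -/
def AdaptiveSolution.probed {U : Type u} {m : ℕ} :
    AdaptiveSolution U m → (Fin m → U) → Finset (Fin m)
  | .done, _ => ∅
  | .probe i next, X => insert i ((next (X i)).probed X)

/-- What is known after the items in `S` have been probed, when the items realize to `X`: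
the realizations of the items in `S`, and nothing about the others. -/
def observed {U : Type u} {m : ℕ} (S : Finset (Fin m)) (X : Fin m → U) : Fin m → Option U :=
  fun i => if i ∈ S then some (X i) else none

/-- A set-based `r`-round adaptive solution: in each of the rounds `k = 0, …, r - 1`, the set of
items to probe in parallel is a function of the realizations seen in all previous rounds. -/
structure SetBasedSolution (U : Type u) (m r : ℕ) where
  /-- the set of items probed in round `k`, given the observations made before round `k` -/
  select : Fin r → (Fin m → Option U) → Finset (Fin m)

namespace SetBasedSolution

variable {U : Type u} {m r : ℕ}

/-- The set of items probed before round `k` when the items realize to `X`. -/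
def probedBefore (B : SetBasedSolution U m r) (X : Fin m → U) : ℕ → Finset (Fin m)
  | 0 => ∅
  | k + 1 =>
    if h : k < r then
      B.probedBefore X k ∪ B.select ⟨k, h⟩ (observed (B.probedBefore X k) X)
    else B.probedBefore X k

/-- The set of items probed in round `k` when the items realize to `X`. -/
def roundSet (B : SetBasedSolution U m r) (X : Fin m → U) (k : Fin r) : Finset (Fin m) :=
  B.select k (observed (B.probedBefore X k) X)

/-- The set of all items probed in the `r` rounds when the items realize to `X`. -/
def probed (B : SetBasedSolution U m r) (X : Fin m → U) : Finset (Fin m) :=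
  B.probedBefore X r

end SetBasedSolution

noncomputable section

namespace CoverInstance

variable {U : Type u} [Fintype U] [DecidableEq U] {m : ℕ}

/-- The maximal value `Q = f(U)`. -/
def Q (I : CoverInstance U m) : ℕ := I.f Finset.univ

/-- `c(S)`, the total cost of the items in `S`. -/
def setCost (I : CoverInstance U m) (S : Finset (Fin m)) : ℝ := ∑ i ∈ S, I.cost i

/-- The items in `S` cover `f` when the items realize to `X`. -/
def Covers (I : CoverInstance U m) (S : Finset (Fin m)) (X : Fin m → U) : Prop :=
  I.f (S.image X) = I.Q

/-- Expectation over the joint distribution of the items. -/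
def expect (I : CoverInstance U m) (g : (Fin m → U) → ℝ) : ℝ := ∑ X, (I.D X).toReal * g X

open Classical in
/-- Probability of an event over the joint distribution of the items. -/
def prob (I : CoverInstance U m) (E : (Fin m → U) → Prop) : ℝ :=
  I.expect fun X => if E X then 1 else 0

/-- Probing all items covers `f` with probability one. -/
def Feasible (I : CoverInstance U m) : Prop := ∀ X ∈ I.D.support, I.Covers Finset.univ X

/-- The cost of an optimal fully adaptive solution: the least expected cost of an adaptive
solution that covers `f` with probability one. -/
def OPT (I : CoverInstance U m) : ℝ :=
  sInf {v | ∃ A : AdaptiveSolution U m, (∀ X ∈ I.D.support, I.Covers (A.probed X) X) ∧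
    v = I.expect fun X => I.setCost (A.probed X)}

/-- The items are mutually independent: their joint distribution is the product of the marginal
distributions. -/
def Independent (I : CoverInstance U m) : Prop :=
  ∀ X : Fin m → U, I.D X = ∏ i, (I.D.map fun Y => Y i) (X i)

/-- The number `s` of scenarios: the support size of the joint distribution. -/
def numScenarios (I : CoverInstance U m) : ℕ := I.D.support.ncard

/-- The expected total cost of a set-based solution, where each round incurs the total cost of the
set of items probed in that round. -/
def setBasedCost (I : CoverInstance U m) {r : ℕ} (B : SetBasedSolution U m r) : ℝ :=
  I.expect fun X => ∑ k : Fin r, I.setCost (B.roundSet X k)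

/-- The probability that a set-based solution covers `f`. -/
def coverProb (I : CoverInstance U m) {r : ℕ} (B : SetBasedSolution U m r) : ℝ :=
  I.prob fun X => I.Covers (B.probed X) X

end CoverInstance

end

/-! Fix an optimal decision tree `A` and an integer residual ρ that vanishes only at covered
outcomes: the missing value Q − f for independent items, and for general distributions the number of
scenarios still compatible with the observations (0 once covered). A round should shrink the
residual by a factor δ = n^(-1/r'), where n = Q or n = s bounds the initial residual, except on an
ε-fraction of each class of realizations with the same observations. After r' such rounds the
integer residual is below 1, hence 0, and a union bound with ε = η/r' gives the success probability.

Within one round the set is built greedily and non-adaptively. Let P be the weight of the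
realizations, among those matching the past observations, whose residual is still at least a
δ-fraction of its value at the start of the round, and let O be the weighted cost of `A` on the
whole class. `MakesProgress` says that some extension N lowers the expected relative residual at
rate at least κδP²/O per unit cost. Integrated against a truncated logarithmic potential
(`exists_descent`, `MakesProgress.exists_round`), this bounds the cost of a round by 4(1 +
log(1/δ))O/(κδt), where t is ε times the weight of the class.

Independent items: `submodular_pairs` shows that the items probed by `A` on one sample help another
sample substantially on average. Whether `A` probes e does not depend on the value of e, so
exchanging the values of e in the two samples (`sum_sum_exchange`) turns this into a bound on Σ
P(`A` probes e) · gain(e). Comparison with Σ P(`A` probes e) · c(e) yields one good item.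

Scenarios: at most 1/δ observation classes inside the current one are still large. For each, N
contains the items that `A`, run within a budget, probes along the most frequent outcomes. A
realization either follows that path and is covered, or deviates from it and loses at least half of
its compatible scenarios. -/

/-! ### Decision trees and truncation to a budget -/

section AdaptiveSolutions

variable {U : Type u} {m : ℕ}

/-- Only the realizations of the probed items matter for what is probed. -/
theorem AdaptiveSolution.probed_congr (A : AdaptiveSolution U m) {X Y : Fin m → U}
    (h : ∀ i ∈ A.probed X, Y i = X i) : A.probed Y = A.probed X := by
  induction A with
  | done => rfl
  | probe i next ih =>
    have hi : Y i = X i := h i (by simp [AdaptiveSolution.probed])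
    simp only [AdaptiveSolution.probed, hi]
    rw [ih (X i) fun j hj => h j (by simp [AdaptiveSolution.probed, hj])]

/-- Whether an item is probed does not depend on its own realization. -/
theorem AdaptiveSolution.mem_probed_update (A : AdaptiveSolution U m) (X : Fin m → U)
    (e : Fin m) (u : U) : e ∈ A.probed (Function.update X e u) ↔ e ∈ A.probed X := by
  induction A with
  | done => rfl
  | probe i next ih =>
    by_cases hi : e = i
    · simp [AdaptiveSolution.probed, hi]
    · have : Function.update X e u i = X i := Function.update_of_ne (Ne.symm hi) _ _
      simp [AdaptiveSolution.probed, this, ih, hi]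

open Classical in
/-- Follow an adaptive solution as long as the total cost of the probed items stays within the
budget `k`; an item is charged only the first time it is probed. -/
noncomputable def AdaptiveSolution.truncate :
    AdaptiveSolution U m → (Fin m → ℝ) → ℝ → AdaptiveSolution U m
  | .done, _, _ => .done
  | .probe i next, c, k =>
    if c i ≤ k then
      .probe i fun u => (next u).truncate (Function.update c i 0) (k - c i)
    else .done

/-- Setting the cost of i to 0 after its first probe makes repeated probes free, so recursion along
a tree computes the cost of the set of probed items. -/
theorem sum_insert_eq_add_sum_update (c : Fin m → ℝ) (i : Fin m) (S : Finset (Fin m)) :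
    ∑ e ∈ insert i S, c e = c i + ∑ e ∈ S, Function.update c i 0 e := by
  rw [← Finset.insert_erase (Finset.mem_insert_self i S),
    Finset.sum_insert (Finset.notMem_erase _ _)]
  congr 1
  rw [Finset.erase_insert_eq_erase]
  have : ∑ e ∈ S, Function.update c i 0 e = ∑ e ∈ S.erase i, Function.update c i 0 e := by
    symm
    apply Finset.sum_subset (Finset.erase_subset _ _)
    intro x hx hx'
    have : x = i := by
      by_contra h
      exact hx' (Finset.mem_erase.2 ⟨h, hx⟩)
    simp [this]
  rw [this]
  refine Finset.sum_congr rfl fun e he => ?_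
  rw [Function.update_of_ne (Finset.ne_of_mem_erase he)]

theorem AdaptiveSolution.sum_truncate_le (A : AdaptiveSolution U m) (X : Fin m → U)
    (c : Fin m → ℝ) (k : ℝ) (hk : 0 ≤ k) : ∑ e ∈ (A.truncate c k).probed X, c e ≤ k := by
  induction A generalizing c k with
  | done => simpa [AdaptiveSolution.truncate, AdaptiveSolution.probed] using hk
  | probe i next ih =>
    by_cases h : c i ≤ k
    · simp only [AdaptiveSolution.truncate, h, if_true, AdaptiveSolution.probed]
      rw [sum_insert_eq_add_sum_update]
      have := ih (X i) (Function.update c i 0) (k - c i) (by linarith)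
      linarith
    · simpa [AdaptiveSolution.truncate, h, AdaptiveSolution.probed] using hk

theorem AdaptiveSolution.truncate_probed (A : AdaptiveSolution U m) (X : Fin m → U)
    (c : Fin m → ℝ) (k : ℝ) (hc : ∀ i, 0 ≤ c i) (h : ∑ e ∈ A.probed X, c e ≤ k) :
    (A.truncate c k).probed X = A.probed X := by
  induction A generalizing c k with
  | done => rfl
  | probe i next ih =>
    simp only [AdaptiveSolution.probed] at h
    rw [sum_insert_eq_add_sum_update] at h
    have hc' : ∀ j, 0 ≤ Function.update c i 0 j := fun j => by
      by_cases hj : j = i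
      · simp [hj]
      · simp [hj, hc]
    have h0 : 0 ≤ ∑ e ∈ (next (X i)).probed X, Function.update c i 0 e :=
      Finset.sum_nonneg fun e _ => hc' e
    have hi : c i ≤ k := by linarith
    simp only [AdaptiveSolution.truncate, hi, if_true, AdaptiveSolution.probed]
    rw [ih (X i) _ _ hc' (by linarith)]

/-- The adaptive solution that probes the items of a list one after the other. -/
def AdaptiveSolution.ofList : List (Fin m) → AdaptiveSolution U m
  | [] => .done
  | i :: l => .probe i fun _ => ofList l

theorem AdaptiveSolution.ofList_probed (l : List (Fin m)) (X : Fin m → U) :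
    (AdaptiveSolution.ofList l).probed X = l.toFinset := by
  induction l with
  | nil => rfl
  | cons i l ih => simp [AdaptiveSolution.ofList, AdaptiveSolution.probed, ih]

end AdaptiveSolutions

/-! ### Observations and consistency of realizations -/

section Observations

variable {U : Type u} {m : ℕ}

theorem observed_eq_iff {S T : Finset (Fin m)} {X Y : Fin m → U} :
    observed S X = observed T Y ↔ S = T ∧ ∀ i ∈ T, X i = Y i := by
  constructor
  · intro h
    have hi : ∀ i, observed S X i = observed T Y i := fun i => by rw [h]
    have hST : S = T := by
      ext i
      have := hi i
      by_cases h1 : i ∈ S <;> by_cases h2 : i ∈ T <;> simp_all [observed]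
    refine ⟨hST, fun i hT => ?_⟩
    have := hi i
    simpa [observed, hST, hT] using this
  · rintro ⟨rfl, h⟩
    funext i
    by_cases hi : i ∈ S
    · simp [observed, hi, h i hi]
    · simp [observed, hi]

theorem observed_self_eq_iff {S : Finset (Fin m)} {X Y : Fin m → U} :
    observed S X = observed S Y ↔ ∀ i ∈ S, X i = Y i := by
  simp [observed_eq_iff]

theorem SetBasedSolution.probedBefore_succ_subset {r : ℕ} (B : SetBasedSolution U m r)
    (X : Fin m → U) (k : ℕ) : B.probedBefore X k ⊆ B.probedBefore X (k + 1) := by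
  rw [SetBasedSolution.probedBefore]
  split_ifs
  · exact Finset.subset_union_left
  · exact subset_rfl

theorem SetBasedSolution.probedBefore_mono {r : ℕ} (B : SetBasedSolution U m r)
    (X : Fin m → U) : Monotone (B.probedBefore X) :=
  monotone_nat_of_le_succ fun k => B.probedBefore_succ_subset X k

theorem SetBasedSolution.probedBefore_congr {r : ℕ} (B : SetBasedSolution U m r)
    {X Y : Fin m → U} (k : ℕ) (h : ∀ i ∈ B.probedBefore X k, Y i = X i) :
    B.probedBefore Y k = B.probedBefore X k := by
  induction k with
  | zero => rfl
  | succ k ih =>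
    have h' : ∀ i ∈ B.probedBefore X k, Y i = X i := fun i hi =>
      h i (B.probedBefore_succ_subset X k hi)
    have h1 := ih h'
    rw [SetBasedSolution.probedBefore, SetBasedSolution.probedBefore, h1,
      observed_self_eq_iff.2 h']

/-- Two realizations lead to the same observations before a round if and only if they agree on
the items that one of them leads to probe. -/
theorem SetBasedSolution.observed_probedBefore_eq_iff {r : ℕ} (B : SetBasedSolution U m r)
    {X Y : Fin m → U} (k : ℕ) :
    observed (B.probedBefore Y k) Y = observed (B.probedBefore X k) X ↔
      observed (B.probedBefore X k) Y = observed (B.probedBefore X k) X := by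
  rw [observed_eq_iff, observed_self_eq_iff]
  exact ⟨fun h => h.2, fun h => ⟨B.probedBefore_congr k h, h⟩⟩

end Observations

/-! ### Greedy descent and the logarithmic potential -/

section Descent

variable {m : ℕ}

/-- Greedy descent: if the potential `Φ` can always be decreased at a rate of at least
`κ P² / O` per unit of cost, then `P` gets down to `t` at cost at most `4 lam O / (κ t)`. -/
theorem exists_descent (c : Fin m → ℝ) (hc : ∀ i, 0 ≤ c i) (P Φ : Finset (Fin m) → ℝ)
    {lam κ O t : ℝ} (hlam : 0 < lam) (hO : 0 ≤ O) (ht : 0 < t)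
    (T : Finset (Fin m)) (hΦ0 : ∀ L, T ⊆ L → 0 ≤ Φ L) (hΦ : ∀ L, T ⊆ L → Φ L ≤ lam * P L)
    (hκ : 0 < κ)
    (hstep : ∀ L, T ⊆ L → t < P L → ∃ N, Φ (L ∪ N) < Φ L ∧
      κ * P L ^ 2 * ∑ i ∈ N, c i ≤ O * (Φ L - Φ (L ∪ N))) :
    ∃ N, P (T ∪ N) ≤ t ∧ κ * t * ∑ i ∈ N, c i ≤ 4 * lam * O := by
  -- Discrete form of ∫ dΦ / P². Before stopping, both t and Φ / lam are at most P, so P ≥ (lam t +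
  -- Φ) / (2 lam); hence each step costs at most a multiple of the increase of 1 / (lam t + Φ), and
  -- these increases telescope. The recursion ends because a strict drop of Φ forces a new item.
  have key : ∀ n : ℕ, ∀ L, T ⊆ L → (Finset.univ \ L).card < n → ∃ N, P (L ∪ N) ≤ t ∧
      κ * ∑ i ∈ N, c i ≤ 4 * lam ^ 2 * O * (1 / (lam * t) - 1 / (lam * t + Φ L)) := by
    intro n
    induction n with
    | zero => exact fun L _ hn => absurd hn (Nat.not_lt_zero _)
    | succ n ih =>
      intro L hL hn
      by_cases hP : P L ≤ t
      · refine ⟨∅, by simpa using hP, ?_⟩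
        have : 1 / (lam * t + Φ L) ≤ 1 / (lam * t) :=
          one_div_le_one_div_of_le (by positivity) (by linarith [hΦ0 L hL])
        simp only [Finset.sum_empty, mul_zero]
        have h2 : 0 ≤ 1 / (lam * t) - 1 / (lam * t + Φ L) := by linarith
        positivity
      · push Not at hP
        obtain ⟨N, hN, hcost⟩ := hstep L hL hP
        have hL' : T ⊆ L ∪ N := hL.trans Finset.subset_union_left
        have hcard : (Finset.univ \ (L ∪ N)).card < n := by
          have hss : Finset.univ \ (L ∪ N) ⊂ Finset.univ \ L := by
            refine Finset.ssubset_iff_subset_ne.2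
              ⟨Finset.sdiff_subset_sdiff subset_rfl Finset.subset_union_left, fun h => ?_⟩
            have : L ∪ N = L := by
              ext i
              have := Finset.ext_iff.1 h i
              simp only [Finset.mem_sdiff, Finset.mem_univ, true_and] at this
              tauto
            rw [this] at hN
            exact lt_irrefl _ hN
          have := Finset.card_lt_card hss
          omega
        obtain ⟨N', hN', hcost'⟩ := ih (L ∪ N) hL' hcard
        refine ⟨N ∪ N', by rwa [← Finset.union_assoc], ?_⟩
        have hsum : ∑ i ∈ N ∪ N', c i ≤ ∑ i ∈ N, c i + ∑ i ∈ N', c i := by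
          rw [← Finset.sum_union_inter]
          linarith [Finset.sum_nonneg fun i (_ : i ∈ N ∩ N') => hc i]
        have h0 := hΦ0 _ hL'
        have hP0 : 0 < P L := ht.trans hP
        have hlt : 0 < lam * t := by positivity
        have hstep1 : κ * ∑ i ∈ N, c i ≤
            4 * lam ^ 2 * O * (1 / (lam * t + Φ (L ∪ N)) - 1 / (lam * t + Φ L)) := by
          have hd1 : 0 < lam * t + Φ (L ∪ N) := by linarith
          have hd2 : 0 < lam * t + Φ L := by linarith
          have hb : lam * t + Φ L ≤ 2 * (lam * P L) := by
            have := hΦ L hL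
            have : lam * t ≤ lam * P L := by gcongr
            linarith
          have hb' : lam * t + Φ (L ∪ N) ≤ 2 * (lam * P L) := by linarith
          have hprod : (lam * t + Φ (L ∪ N)) * (lam * t + Φ L) ≤ 4 * lam ^ 2 * P L ^ 2 := by
            calc _ ≤ (2 * (lam * P L)) * (2 * (lam * P L)) := by gcongr
              _ = _ := by ring
          have heq : 1 / (lam * t + Φ (L ∪ N)) - 1 / (lam * t + Φ L) =
              (Φ L - Φ (L ∪ N)) / ((lam * t + Φ (L ∪ N)) * (lam * t + Φ L)) := by
            field_simp
            ring
          rw [heq, ← mul_div_assoc, le_div_iff₀ (by positivity)]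
          have hκc : 0 ≤ κ * ∑ i ∈ N, c i :=
            mul_nonneg hκ.le (Finset.sum_nonneg fun i _ => hc i)
          calc (κ * ∑ i ∈ N, c i) * ((lam * t + Φ (L ∪ N)) * (lam * t + Φ L))
              ≤ (κ * ∑ i ∈ N, c i) * (4 * lam ^ 2 * P L ^ 2) := by gcongr
            _ = 4 * lam ^ 2 * (κ * P L ^ 2 * ∑ i ∈ N, c i) := by ring
            _ ≤ 4 * lam ^ 2 * (O * (Φ L - Φ (L ∪ N))) := by gcongr
            _ = 4 * lam ^ 2 * O * (Φ L - Φ (L ∪ N)) := by ring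
        calc κ * ∑ i ∈ N ∪ N', c i ≤ κ * (∑ i ∈ N, c i + ∑ i ∈ N', c i) := by gcongr
          _ ≤ _ := by rw [mul_add]; linarith
  obtain ⟨N, hN, hcost⟩ := key _ T subset_rfl (Nat.lt_succ_self _)
  refine ⟨N, hN, ?_⟩
  have h0 : 0 ≤ 1 / (lam * t + Φ T) := by
    have := hΦ0 T subset_rfl
    positivity
  calc κ * t * ∑ i ∈ N, c i = t * (κ * ∑ i ∈ N, c i) := by ring
    _ ≤ t * (4 * lam ^ 2 * O * (1 / (lam * t) - 1 / (lam * t + Φ T))) :=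
      mul_le_mul_of_nonneg_left hcost ht.le
    _ ≤ t * (4 * lam ^ 2 * O * (1 / (lam * t))) := by
      gcongr
      linarith
    _ = 4 * lam * O := by field_simp

/-- A logarithmic potential that vanishes below the threshold `θ`. -/
noncomputable def truncatedLog (θ v : ℝ) : ℝ := if θ ≤ v then 1 + Real.log (v / θ) else 0

theorem truncatedLog_nonneg {θ : ℝ} (hθ : 0 < θ) (v : ℝ) : 0 ≤ truncatedLog θ v := by
  unfold truncatedLog
  split_ifs with h
  · have := Real.log_nonneg ((one_le_div hθ).2 h)
    linarith
  · exact le_rfl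

theorem truncatedLog_le {θ v R : ℝ} (hθ : 0 < θ) (hv : v ≤ R) (hθv : θ ≤ v) :
    truncatedLog θ v ≤ 1 + Real.log (R / θ) := by
  rw [truncatedLog, if_pos hθv]
  have h0 : 0 < v / θ := div_pos (hθ.trans_le hθv) hθ
  have := Real.log_le_log h0 (div_le_div_of_nonneg_right hv hθ.le)
  linarith

/-- Above the threshold this is 1 − 1/x ≤ log x. If v' falls below the threshold, the jump of height
1 alone pays for the relative decrease, which is at most 1. -/
theorem le_truncatedLog_sub {θ v v' : ℝ} (hθ : 0 < θ) (hθv : θ ≤ v) (hv' : 0 ≤ v') :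
    (v - v') / v ≤ truncatedLog θ v - truncatedLog θ v' := by
  have hv : 0 < v := hθ.trans_le hθv
  by_cases h : θ ≤ v'
  · have hv'0 : 0 < v' := hθ.trans_le h
    rw [truncatedLog, truncatedLog, if_pos hθv, if_pos h]
    have h1 := Real.one_sub_inv_le_log_of_pos (div_pos hv hv'0)
    rw [Real.log_div hv.ne' hv'0.ne'] at h1
    rw [Real.log_div hv.ne' hθ.ne', Real.log_div hv'0.ne' hθ.ne', sub_div, div_self hv.ne']
    rw [inv_div] at h1
    linarith
  · rw [truncatedLog, truncatedLog, if_pos hθv, if_neg h]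
    have h1 : (v - v') / v ≤ 1 := (div_le_one hv).2 (by linarith)
    have h2 := Real.log_nonneg ((one_le_div hθ).2 hθv)
    linarith

end Descent

/-! ### From a progress rate to rounds -/

section Rounds

variable {U : Type u} [Fintype U] {m : ℕ}

open Classical in
/-- The realizations that agree with `x` on the items in `T`. -/
noncomputable def agreeClass (T : Finset (Fin m)) (x : Fin m → U) : Finset (Fin m → U) :=
  Finset.univ.filter fun X => observed T X = observed T x

theorem mem_agreeClass {T : Finset (Fin m)} {x X : Fin m → U} :
    X ∈ agreeClass T x ↔ ∀ i ∈ T, X i = x i := by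
  classical
  simp [agreeClass, observed_self_eq_iff]

theorem agreeClass_congr {T : Finset (Fin m)} {x y : Fin m → U}
    (h : observed T x = observed T y) : agreeClass T x = agreeClass T y := by
  classical
  simp [agreeClass, h]

open Classical in
/-- Whatever has been probed, as long as there is much left to do with positive probability, some
set of items makes progress at a good rate. Here `ρ S X` measures what is left to do after probing
`S`, the weights `w` are those of the realizations, and `a` is the cost of a reference
solution. -/
def MakesProgress (w a : (Fin m → U) → ℝ) (c : Fin m → ℝ) (ρ : Finset (Fin m) → (Fin m → U) → ℕ)
    (κ : ℝ) : Prop :=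
  ∀ (T L : Finset (Fin m)) (x : Fin m → U) (δ : ℝ), 0 < δ → δ ≤ 1 → T ⊆ L → 0 < ρ T x →
    0 < ∑ X ∈ agreeClass T x with δ * ρ T x ≤ ρ L X, w X →
    ∃ N : Finset (Fin m),
      0 < ∑ X ∈ agreeClass T x with δ * ρ T x ≤ ρ L X,
          w X * (((ρ L X : ℝ) - ρ (L ∪ N) X) / ρ L X) ∧
      κ * δ * (∑ X ∈ agreeClass T x with δ * ρ T x ≤ ρ L X, w X) ^ 2 * ∑ i ∈ N, c i ≤
        (∑ X ∈ agreeClass T x, w X * a X) *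
          ∑ X ∈ agreeClass T x with δ * ρ T x ≤ ρ L X,
            w X * (((ρ L X : ℝ) - ρ (L ∪ N) X) / ρ L X)

open Classical in
-- Greedy descent with P the weight of the realizations whose residual is at least θ = δ ρ(T, x),
-- and Φ the weighted truncated logarithm of the residual. The potential of one realization is at
-- most 1 + log(1/δ), and its drop dominates the relative decrease in `MakesProgress`.
theorem MakesProgress.exists_round {w a : (Fin m → U) → ℝ} {c : Fin m → ℝ}
    {ρ : Finset (Fin m) → (Fin m → U) → ℕ} {κ : ℝ} (h : MakesProgress w a c ρ κ)
    (hw : ∀ X, 0 ≤ w X) (ha : ∀ X, 0 ≤ a X) (hc : ∀ i, 0 ≤ c i) (hκ : 0 < κ)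
    (hρ : ∀ S T X, S ⊆ T → ρ T X ≤ ρ S X)
    (hρ' : ∀ S X Y, (∀ i ∈ S, X i = Y i) → ρ S X = ρ S Y)
    {δ ε : ℝ} (hδ : 0 < δ) (hδ1 : δ ≤ 1) (hε : 0 < ε) (T : Finset (Fin m)) (x : Fin m → U) :
    ∃ N : Finset (Fin m),
      κ * δ * ε * ∑ X ∈ agreeClass T x, w X * ∑ i ∈ N, c i ≤
        4 * (1 + Real.log (1 / δ)) * ∑ X ∈ agreeClass T x, w X * a X ∧
      ∑ X ∈ agreeClass T x with 0 < ρ (T ∪ N) X ∧ δ * ρ T X ≤ ρ (T ∪ N) X, w X ≤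
        ε * ∑ X ∈ agreeClass T x, w X := by
  have hlog : 0 ≤ Real.log (1 / δ) := Real.log_nonneg ((one_le_div hδ).2 hδ1)
  have hO : 0 ≤ ∑ X ∈ agreeClass T x, w X * a X :=
    Finset.sum_nonneg fun X _ => mul_nonneg (hw X) (ha X)
  have hW : 0 ≤ ∑ X ∈ agreeClass T x, w X := Finset.sum_nonneg fun X _ => hw X
  have hρT : ∀ X ∈ agreeClass T x, ρ T X = ρ T x := fun X hX => hρ' T X x (mem_agreeClass.1 hX)
  -- A finished class or a class of weight zero needs no items; otherwise the thresholds θ and t of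
  -- the descent are positive. The condition 0 < ρ in the bad event excludes finished realizations,
  -- for which δ · 0 ≤ 0 would count as failure.
  rcases Nat.eq_zero_or_pos (ρ T x) with h0 | h0
  · refine ⟨∅, ?_, ?_⟩
    · simp only [Finset.sum_empty, mul_zero, Finset.sum_const_zero]
      positivity
    · rw [Finset.filter_false_of_mem]
      · simp only [Finset.sum_empty]
        positivity
      · intro X hX
        simp [hρT X hX, h0]
  rcases hW.eq_or_lt with hW0 | hW0
  · refine ⟨∅, ?_, ?_⟩
    · simp only [Finset.sum_empty, mul_zero, Finset.sum_const_zero]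
      positivity
    · rw [← hW0, mul_zero]
      rw [hW0]
      exact Finset.sum_le_sum_of_subset_of_nonneg (Finset.filter_subset _ _) fun X _ _ => hw X
  have hR : (0 : ℝ) < ρ T x := by exact_mod_cast h0
  have hθ : 0 < δ * ρ T x := by positivity
  have hsplit : ∀ L, ∑ X ∈ agreeClass T x, w X * truncatedLog (δ * ρ T x) (ρ L X) =
      ∑ X ∈ agreeClass T x with δ * ρ T x ≤ ρ L X,
        w X * truncatedLog (δ * ρ T x) (ρ L X) := by
    intro L
    rw [Finset.sum_filter]
    refine Finset.sum_congr rfl fun X _ => ?_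
    split_ifs with hX
    · rfl
    · simp [truncatedLog, hX]
  have hdrop : ∀ L N, ∑ X ∈ agreeClass T x with δ * ρ T x ≤ ρ L X,
      w X * (((ρ L X : ℝ) - ρ (L ∪ N) X) / ρ L X) ≤
      (∑ X ∈ agreeClass T x, w X * truncatedLog (δ * ρ T x) (ρ L X)) -
        ∑ X ∈ agreeClass T x, w X * truncatedLog (δ * ρ T x) (ρ (L ∪ N) X) := by
    intro L N
    rw [hsplit L]
    have : ∑ X ∈ agreeClass T x, w X * truncatedLog (δ * ρ T x) (ρ (L ∪ N) X) =
        ∑ X ∈ agreeClass T x with δ * ρ T x ≤ ρ L X,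
          w X * truncatedLog (δ * ρ T x) (ρ (L ∪ N) X) := by
      rw [Finset.sum_filter]
      refine Finset.sum_congr rfl fun X _ => ?_
      split_ifs with hX
      · rfl
      · have h1 : (ρ (L ∪ N) X : ℝ) ≤ ρ L X := by
          exact_mod_cast hρ _ _ X Finset.subset_union_left
        have h2 : ¬ δ * ρ T x ≤ ρ (L ∪ N) X := fun h2 => hX (h2.trans h1)
        simp [truncatedLog, h2]
    rw [this, ← Finset.sum_sub_distrib]
    refine Finset.sum_le_sum fun X hX => ?_
    rw [← mul_sub]
    exact mul_le_mul_of_nonneg_left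
      (le_truncatedLog_sub hθ (Finset.mem_filter.1 hX).2 (Nat.cast_nonneg _)) (hw X)
  obtain ⟨N, hN, hcost⟩ := exists_descent c hc
    (fun L => ∑ X ∈ agreeClass T x with δ * ρ T x ≤ ρ L X, w X)
    (fun L => ∑ X ∈ agreeClass T x, w X * truncatedLog (δ * ρ T x) (ρ L X))
    (lam := 1 + Real.log (1 / δ)) (κ := κ * δ) (O := ∑ X ∈ agreeClass T x, w X * a X)
    (t := ε * ∑ X ∈ agreeClass T x, w X)
    (by linarith) hO (by positivity) T
    (fun L _ => Finset.sum_nonneg fun X _ => mul_nonneg (hw X) (truncatedLog_nonneg hθ _))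
    (fun L hL => by
      rw [hsplit L, Finset.mul_sum]
      refine Finset.sum_le_sum fun X hX => ?_
      rw [mul_comm (w X)]
      refine mul_le_mul_of_nonneg_right ?_ (hw X)
      have hX' := Finset.mem_filter.1 hX
      have h1 : (ρ L X : ℝ) ≤ ρ T x := by
        rw [← hρT X hX'.1]
        exact_mod_cast hρ _ _ X hL
      have h2 := truncatedLog_le hθ h1 hX'.2
      have h3 : (ρ T x : ℝ) / (δ * ρ T x) = 1 / δ := by field_simp
      rwa [h3] at h2)
    (by positivity)
    (fun L hL hP => by
      have hP0 : 0 < ε * ∑ X ∈ agreeClass T x, w X := by positivity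
      obtain ⟨N, hN, hcost⟩ := h T L x δ hδ hδ1 hL h0 (hP0.trans hP)
      have := hdrop L N
      refine ⟨N, by linarith, hcost.trans ?_⟩
      exact mul_le_mul_of_nonneg_left this hO)
  refine ⟨N, ?_, ?_⟩
  · rw [← Finset.sum_mul]
    calc _ = κ * δ * (ε * ∑ X ∈ agreeClass T x, w X) * ∑ i ∈ N, c i := by ring
      _ ≤ _ := hcost
  · refine le_trans (Finset.sum_le_sum_of_subset_of_nonneg ?_ fun X _ _ => hw X) hN
    intro X hX
    simp only [Finset.mem_filter] at hX ⊢
    refine ⟨hX.1, ?_⟩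
    rw [← hρT X hX.1]
    exact hX.2.2

/-- To compare two sums over all realizations, it suffices to compare them on each class of
realizations with the same observations before round `k`. -/
theorem sum_le_sum_of_agreeClass {r : ℕ} (B : SetBasedSolution U m r) (k : ℕ)
    (g h : (Fin m → U) → ℝ)
    (hgh : ∀ x, ∑ X ∈ agreeClass (B.probedBefore x k) x, g X ≤
      ∑ X ∈ agreeClass (B.probedBefore x k) x, h X) :
    ∑ X, g X ≤ ∑ X, h X := by
  classical
  rw [← Finset.sum_fiberwise Finset.univ (fun X => observed (B.probedBefore X k) X) g,
    ← Finset.sum_fiberwise Finset.univ (fun X => observed (B.probedBefore X k) X) h]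
  refine Finset.sum_le_sum fun o _ => ?_
  by_cases ho : ∃ x, observed (B.probedBefore x k) x = o
  · obtain ⟨x, rfl⟩ := ho
    simpa only [B.observed_probedBefore_eq_iff k, agreeClass] using hgh x
  · rw [Finset.filter_false_of_mem fun X _ hX => ho ⟨X, hX⟩]
    simp

open Classical in
/-- Playing `r' ≤ r` rounds, each of which reduces what is left to do by a factor `δ` except with
probability `ε`. -/
theorem MakesProgress.exists_setBasedSolution {w a : (Fin m → U) → ℝ} {c : Fin m → ℝ}
    {ρ : Finset (Fin m) → (Fin m → U) → ℕ} {κ : ℝ} (h : MakesProgress w a c ρ κ)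
    (hw : ∀ X, 0 ≤ w X) (ha : ∀ X, 0 ≤ a X) (hc : ∀ i, 0 ≤ c i) (hκ : 0 < κ)
    (hρ : ∀ S T X, S ⊆ T → ρ T X ≤ ρ S X)
    (hρ' : ∀ S X Y, (∀ i ∈ S, X i = Y i) → ρ S X = ρ S Y)
    {δ ε : ℝ} (hδ : 0 < δ) (hδ1 : δ ≤ 1) (hε : 0 < ε) {n r r' : ℕ} (hn : ∀ X, ρ ∅ X ≤ n)
    (hr' : 1 ≤ r') (hr : r' ≤ r) (hδn : δ ^ r' * n ≤ 1) :
    ∃ B : SetBasedSolution U m r,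
      κ * δ * ε * ∑ X, w X * ∑ k : Fin r, ∑ i ∈ B.roundSet X k, c i ≤
        r' * (4 * (1 + Real.log (1 / δ)) * ∑ X, w X * a X) ∧
      ∑ X with ρ (B.probed X) X ≠ 0, w X ≤ r' * ε * ∑ X, w X := by
  choose N hN using h.exists_round hw ha hc hκ hρ hρ' hδ hδ1 hε
  -- An observation determines both the probed set and the class of realizations, so the choice made
  -- for one representative serves them all and is a legitimate selection rule.
  have hsel : ∀ o : Fin m → Option U, ∃ M : Finset (Fin m), ∀ T x, observed T x = o →
      κ * δ * ε * ∑ X ∈ agreeClass T x, w X * ∑ i ∈ M, c i ≤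
        4 * (1 + Real.log (1 / δ)) * ∑ X ∈ agreeClass T x, w X * a X ∧
      ∑ X ∈ agreeClass T x with 0 < ρ (T ∪ M) X ∧ δ * ρ T X ≤ ρ (T ∪ M) X, w X ≤
        ε * ∑ X ∈ agreeClass T x, w X := by
    intro o
    by_cases ho : ∃ T x, observed T x = o
    · obtain ⟨T, x, rfl⟩ := ho
      refine ⟨N T x, fun T' x' h' => ?_⟩
      obtain ⟨rfl, h2⟩ := observed_eq_iff.1 h'
      rw [agreeClass_congr h']
      exact hN T' x
    · exact ⟨∅, fun T x h' => absurd ⟨T, x, h'⟩ ho⟩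
  choose M hM using hsel
  let B : SetBasedSolution U m r := ⟨fun k o => if (k : ℕ) < r' then M o else ∅⟩
  have hround : ∀ X (k : Fin r), B.roundSet X k =
      if (k : ℕ) < r' then M (observed (B.probedBefore X k) X) else ∅ := fun X k => rfl
  have hsucc : ∀ X k, k < r' → B.probedBefore X (k + 1) =
      B.probedBefore X k ∪ M (observed (B.probedBefore X k) X) := by
    intro X k hk
    rw [SetBasedSolution.probedBefore, dif_pos (hk.trans_le hr)]
    simp [B, hk]
  have hobs : ∀ k x X, X ∈ agreeClass (B.probedBefore x k) x →
      B.probedBefore X k = B.probedBefore x k ∧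
      observed (B.probedBefore X k) X = observed (B.probedBefore x k) x := by
    intro k x X hX
    have h1 := B.probedBefore_congr k (mem_agreeClass.1 hX)
    exact ⟨h1, observed_eq_iff.2 ⟨h1, mem_agreeClass.1 hX⟩⟩
  refine ⟨B, ?_, ?_⟩
  · have hk : ∀ k : Fin r, κ * δ * ε * ∑ X, w X * ∑ i ∈ B.roundSet X k, c i ≤
        if (k : ℕ) < r' then 4 * (1 + Real.log (1 / δ)) * ∑ X, w X * a X else 0 := by
      intro k
      split_ifs with hk
      · rw [Finset.mul_sum, Finset.mul_sum]
        refine sum_le_sum_of_agreeClass B k _ _ fun x => ?_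
        rw [← Finset.mul_sum, ← Finset.mul_sum]
        refine le_trans (le_of_eq ?_) (hM _ (B.probedBefore x k) x rfl).1
        congr 1
        refine Finset.sum_congr rfl fun X hX => ?_
        rw [hround, if_pos hk, (hobs k x X hX).2]
      · simp [hround, hk]
    calc κ * δ * ε * ∑ X, w X * ∑ k : Fin r, ∑ i ∈ B.roundSet X k, c i
        = ∑ k : Fin r, κ * δ * ε * ∑ X, w X * ∑ i ∈ B.roundSet X k, c i := by
          rw [← Finset.mul_sum, Finset.sum_comm]
          simp only [Finset.mul_sum]
      _ ≤ ∑ k : Fin r,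
          if (k : ℕ) < r' then 4 * (1 + Real.log (1 / δ)) * ∑ X, w X * a X else 0 :=
          Finset.sum_le_sum fun k _ => hk k
      _ = _ := by
          rw [Fin.sum_univ_eq_sum_range
            (fun k => if k < r' then 4 * (1 + Real.log (1 / δ)) * ∑ X, w X * a X else 0) r,
            ← Finset.sum_filter]
          have : (Finset.range r).filter (fun k => k < r') = Finset.range r' := by
            ext k
            simp only [Finset.mem_filter, Finset.mem_range]
            omega
          rw [this]
          simp
  · have hbad : ∀ k < r', ∑ X with 0 < ρ (B.probedBefore X (k + 1)) X ∧
        δ * ρ (B.probedBefore X k) X ≤ ρ (B.probedBefore X (k + 1)) X, w X ≤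
        ε * ∑ X, w X := by
      intro k hk
      rw [Finset.sum_filter, Finset.mul_sum]
      refine sum_le_sum_of_agreeClass B k _ _ fun x => ?_
      rw [← Finset.mul_sum, ← Finset.sum_filter]
      refine le_trans (le_of_eq ?_) (hM _ (B.probedBefore x k) x rfl).2
      refine Finset.sum_congr (Finset.filter_congr fun X hX => ?_) fun _ _ => rfl
      rw [hsucc X k hk, (hobs k x X hX).2, (hobs k x X hX).1]
    -- Without failures the residual is at most δ^k n before round k. The strict inequality in the
    -- last round pushes it below δ^r' n ≤ 1, so by integrality it is 0.
    have hcov : ∀ X, (∀ k < r', ¬ (0 < ρ (B.probedBefore X (k + 1)) X ∧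
        δ * ρ (B.probedBefore X k) X ≤ ρ (B.probedBefore X (k + 1)) X)) →
        ρ (B.probed X) X = 0 := by
      intro X hX
      have hstep : ∀ k < r', (ρ (B.probedBefore X k) X : ℝ) ≤ δ ^ k * n →
          ρ (B.probedBefore X (k + 1)) X = 0 ∨
            (ρ (B.probedBefore X (k + 1)) X : ℝ) < δ ^ (k + 1) * n := by
        intro k hk hle
        have := hX k hk
        rw [not_and, not_le] at this
        rcases Nat.eq_zero_or_pos (ρ (B.probedBefore X (k + 1)) X) with h0 | h0
        · exact Or.inl h0
        · refine Or.inr ((this h0).trans_le ?_)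
          calc δ * ρ (B.probedBefore X k) X ≤ δ * (δ ^ k * n) := by gcongr
            _ = δ ^ (k + 1) * n := by ring
      have hle : ∀ k ≤ r', (ρ (B.probedBefore X k) X : ℝ) ≤ δ ^ k * n := by
        intro k
        induction k with
        | zero => exact fun _ => by simpa [SetBasedSolution.probedBefore] using hn X
        | succ k ih =>
          intro hk
          rcases hstep k hk (ih (by omega)) with h1 | h1
          · rw [h1, Nat.cast_zero]
            positivity
          · exact h1.le
      obtain ⟨k, rfl⟩ : ∃ k, r' = k + 1 := ⟨r' - 1, by omega⟩
      have h1 : ρ (B.probedBefore X (k + 1)) X = 0 := by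
        rcases hstep k (by omega) (hle k (by omega)) with h1 | h1
        · exact h1
        · have : (ρ (B.probedBefore X (k + 1)) X : ℝ) < 1 := h1.trans_le hδn
          exact Nat.lt_one_iff.1 (by exact_mod_cast this)
      exact Nat.le_zero.1 ((hρ _ _ X (B.probedBefore_mono X hr)).trans h1.le)
    calc ∑ X with ρ (B.probed X) X ≠ 0, w X
        ≤ ∑ X, ∑ k ∈ Finset.range r', if 0 < ρ (B.probedBefore X (k + 1)) X ∧
            δ * ρ (B.probedBefore X k) X ≤ ρ (B.probedBefore X (k + 1)) X then w X else 0 := by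
          rw [Finset.sum_filter]
          refine Finset.sum_le_sum fun X _ => ?_
          have h0 : ∀ k ∈ Finset.range r', 0 ≤ if 0 < ρ (B.probedBefore X (k + 1)) X ∧
            δ * ρ (B.probedBefore X k) X ≤ ρ (B.probedBefore X (k + 1)) X then w X else 0 := by
            intro k _
            split_ifs
            · exact hw X
            · exact le_rfl
          split_ifs with hX
          · have hex : ¬ ∀ k < r', ¬ (0 < ρ (B.probedBefore X (k + 1)) X ∧
              δ * ρ (B.probedBefore X k) X ≤ ρ (B.probedBefore X (k + 1)) X) :=
              fun hall => hX (hcov X hall)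
            push Not at hex
            obtain ⟨k, hk, hk'⟩ := hex
            refine le_trans (le_of_eq ?_) (Finset.single_le_sum h0 (Finset.mem_range.2 hk))
            rw [if_pos hk']
          · exact Finset.sum_nonneg h0
      _ = ∑ k ∈ Finset.range r', ∑ X with 0 < ρ (B.probedBefore X (k + 1)) X ∧
            δ * ρ (B.probedBefore X k) X ≤ ρ (B.probedBefore X (k + 1)) X, w X := by
          rw [Finset.sum_comm]
          simp only [Finset.sum_filter]
      _ ≤ ∑ k ∈ Finset.range r', ε * ∑ X, w X :=
          Finset.sum_le_sum fun k hk => hbad k (Finset.mem_range.1 hk)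
      _ = _ := by
          simp
          ring

end Rounds

/-! ### An averaging inequality for submodular functions -/

section Submodular

variable {U : Type u} [DecidableEq U] {F : Finset U → ℝ}

theorem submodular_diminishing (hmono : ∀ A B, A ⊆ B → F A ≤ F B)
    (hsub : ∀ A B, F (A ∪ B) + F (A ∩ B) ≤ F A + F B) {A B : Finset U} (h : A ⊆ B)
    (C : Finset U) : F (C ∪ B) - F B ≤ F (C ∪ A) - F A := by
  have h1 := hsub (C ∪ A) B
  have h2 : C ∪ A ∪ B = C ∪ B := by rw [Finset.union_assoc, Finset.union_eq_right.2 h]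
  have h3 : F A ≤ F ((C ∪ A) ∩ B) := hmono _ _ (Finset.subset_inter Finset.subset_union_right h)
  rw [h2] at h1
  linarith

theorem submodular_image_le_sum {ι : Type*} [DecidableEq ι] (hmono : ∀ A B, A ⊆ B → F A ≤ F B)
    (hsub : ∀ A B, F (A ∪ B) + F (A ∩ B) ≤ F A + F B) (V : Finset U) (N : Finset ι) (X : ι → U) :
    F (N.image X ∪ V) - F V ≤ ∑ e ∈ N, (F (insert (X e) V) - F V) := by
  induction N using Finset.induction_on with
  | empty => simp
  | insert e N he ih =>
    rw [Finset.sum_insert he, Finset.image_insert, Finset.insert_union]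
    have := submodular_diminishing hmono hsub
      (Finset.subset_union_right : V ⊆ N.image X ∪ V) {X e}
    rw [Finset.singleton_union, Finset.singleton_union] at this
    linarith

variable {Ω : Type*}

/-- Add `T x` for k independent samples x to S. With h(S) the mean of F(S ∪ V y) − F(V y), one
sample gains at least E − h(S) on average, since `T x` completes `V x` and marginals diminish, while
h grows by at most G on average. Summing E − h(S) − jG over j < k gives the bound, as F never
exceeds q. The induction averages over the first sample. -/
theorem submodular_pairs_aux (hmono : ∀ A B, A ⊆ B → F A ≤ F B)
    (hsub : ∀ A B, F (A ∪ B) + F (A ∩ B) ≤ F A + F B) (s : Finset Ω) {μ : Ω → ℝ}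
    (hμ : ∀ x ∈ s, 0 ≤ μ x) (hμ1 : ∑ x ∈ s, μ x = 1) (V T : Ω → Finset U) {q : ℝ}
    (hq : ∀ A, F A ≤ q) (hcov : ∀ x ∈ s, μ x ≠ 0 → F (T x ∪ V x) = q) (k : ℕ) (S : Finset U) :
    F S - k * ∑ y ∈ s, μ y * (F (S ∪ V y) - F (V y)) + k * ∑ y ∈ s, μ y * (q - F (V y)) -
      k * (k - 1) / 2 * ∑ x ∈ s, μ x * ∑ y ∈ s, μ y * (F (T x ∪ V y) - F (V y)) ≤ q := by
  induction k generalizing S with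
  | zero => simpa using hq S
  | succ k ih =>
    set h : Finset U → ℝ := fun S => ∑ y ∈ s, μ y * (F (S ∪ V y) - F (V y)) with hh
    set E := ∑ y ∈ s, μ y * (q - F (V y)) with hE
    set G := ∑ x ∈ s, μ x * ∑ y ∈ s, μ y * (F (T x ∪ V y) - F (V y)) with hG
    have hx : ∀ x ∈ s, μ x * (F S + ((q - F (V x)) - (F (S ∪ V x) - F (V x))) -
        k * (h S + ∑ y ∈ s, μ y * (F (T x ∪ V y) - F (V y))) + k * E -
        k * (k - 1) / 2 * G) ≤ μ x * q := by
      intro x hx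
      by_cases h0 : μ x = 0
      · simp [h0]
      refine mul_le_mul_of_nonneg_left ?_ (hμ x hx)
      have h1 := ih (T x ∪ S)
      have h2 : q - F (S ∪ V x) ≤ F (T x ∪ S) - F S := by
        refine le_trans ?_ (submodular_diminishing hmono hsub
          (Finset.subset_union_left : S ⊆ S ∪ V x) (T x))
        have : q ≤ F (T x ∪ (S ∪ V x)) := by
          rw [← hcov x hx h0]
          exact hmono _ _ (Finset.union_subset_union_right Finset.subset_union_right)
        linarith
      have h3 : h (T x ∪ S) ≤ h S + ∑ y ∈ s, μ y * (F (T x ∪ V y) - F (V y)) := by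
        rw [hh, ← Finset.sum_add_distrib]
        refine Finset.sum_le_sum fun y hy => ?_
        rw [← mul_add]
        refine mul_le_mul_of_nonneg_left ?_ (hμ y hy)
        have := submodular_diminishing hmono hsub
          (Finset.subset_union_right : V y ⊆ S ∪ V y) (T x)
        rw [Finset.union_assoc]
        linarith
      have h4 := mul_le_mul_of_nonneg_left h3 (Nat.cast_nonneg (α := ℝ) k)
      change F (T x ∪ S) - k * h (T x ∪ S) + k * E - k * (k - 1) / 2 * G ≤ q at h1
      linarith
    have hsum := Finset.sum_le_sum hx
    rw [← Finset.sum_mul, hμ1, one_mul] at hsum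
    have hexp : ∑ x ∈ s, μ x * (F S + ((q - F (V x)) - (F (S ∪ V x) - F (V x))) -
        k * (h S + ∑ y ∈ s, μ y * (F (T x ∪ V y) - F (V y))) + k * E -
        k * (k - 1) / 2 * G) =
        (∑ x ∈ s, μ x) * (F S - k * h S + k * E - k * (k - 1) / 2 * G) + E - h S - k * G := by
      have hterm : ∀ x ∈ s, μ x * (F S + ((q - F (V x)) - (F (S ∪ V x) - F (V x))) -
          k * (h S + ∑ y ∈ s, μ y * (F (T x ∪ V y) - F (V y))) + k * E -
          k * (k - 1) / 2 * G) =
          μ x * (F S - k * h S + k * E - k * (k - 1) / 2 * G) + μ x * (q - F (V x)) -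
            μ x * (F (S ∪ V x) - F (V x)) -
            k * (μ x * ∑ y ∈ s, μ y * (F (T x ∪ V y) - F (V y))) := fun x _ => by ring
      rw [Finset.sum_congr rfl hterm, Finset.sum_sub_distrib, Finset.sum_sub_distrib,
        Finset.sum_add_distrib, ← Finset.sum_mul, ← Finset.mul_sum]
    rw [hexp, hμ1] at hsum
    push_cast
    calc _ = 1 * (F S - k * h S + k * E - k * (k - 1) / 2 * G) + E - h S - k * G := by ring
      _ ≤ q := hsum

/-- If each `T x` completes `V x`, then on average `T x` contributes a lot to `V y` for
independent `x` and `y`. -/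
theorem submodular_pairs (hmono : ∀ A B, A ⊆ B → F A ≤ F B)
    (hsub : ∀ A B, F (A ∪ B) + F (A ∩ B) ≤ F A + F B) (s : Finset Ω) {μ : Ω → ℝ}
    (hμ : ∀ x ∈ s, 0 ≤ μ x) (V T : Ω → Finset U) {q : ℝ}
    (hq : ∀ A, F A ≤ q) (hcov : ∀ x ∈ s, μ x ≠ 0 → F (T x ∪ V x) = q) {S : Finset U}
    (hS : ∀ x ∈ s, S ⊆ V x) :
    (∑ y ∈ s, μ y * (q - F (V y))) ^ 2 ≤
      2 * (q - F S) * ∑ x ∈ s, μ x * ∑ y ∈ s, μ y * (F (T x ∪ V y) - F (V y)) := by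
  have hM : 0 ≤ ∑ x ∈ s, μ x := Finset.sum_nonneg hμ
  rcases hM.eq_or_lt with hM0 | hM0
  · have h0 := (Finset.sum_eq_zero_iff_of_nonneg hμ).1 hM0.symm
    have h1 : ∑ y ∈ s, μ y * (q - F (V y)) = 0 :=
      Finset.sum_eq_zero fun y hy => by rw [h0 y hy, zero_mul]
    have h2 : ∑ x ∈ s, μ x * ∑ y ∈ s, μ y * (F (T x ∪ V y) - F (V y)) = 0 :=
      Finset.sum_eq_zero fun y hy => by rw [h0 y hy, zero_mul]
    rw [h1, h2]
    simp
  set M := ∑ x ∈ s, μ x with hMdef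
  have hμ' : ∀ x ∈ s, 0 ≤ μ x / M := fun x hx => div_nonneg (hμ x hx) hM
  have hμ1 : ∑ x ∈ s, μ x / M = 1 := by rw [← Finset.sum_div, div_self hM0.ne']
  have key := fun k : ℕ => submodular_pairs_aux hmono hsub s hμ' hμ1 V T hq
    (fun x hx h => hcov x hx fun h' => h (by rw [h', zero_div])) k S
  have hSV : ∑ y ∈ s, μ y / M * (F (S ∪ V y) - F (V y)) = 0 :=
    Finset.sum_eq_zero fun y hy => by rw [Finset.union_eq_right.2 (hS y hy), sub_self, mul_zero]
  simp only [hSV, mul_zero, sub_zero] at key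
  set E := ∑ y ∈ s, μ y / M * (q - F (V y)) with hE
  set G := ∑ x ∈ s, μ x / M * ∑ y ∈ s, μ y / M * (F (T x ∪ V y) - F (V y)) with hG
  have hE' : ∑ y ∈ s, μ y * (q - F (V y)) = M * E := by
    rw [hE, Finset.mul_sum]
    refine Finset.sum_congr rfl fun y _ => ?_
    field_simp
  have hG' : ∑ x ∈ s, μ x * ∑ y ∈ s, μ y * (F (T x ∪ V y) - F (V y)) = M ^ 2 * G := by
    rw [hG, Finset.mul_sum]
    refine Finset.sum_congr rfl fun x _ => ?_
    rw [Finset.mul_sum, Finset.mul_sum, Finset.mul_sum]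
    refine Finset.sum_congr rfl fun y _ => ?_
    field_simp
  have hG0 : 0 ≤ G := Finset.sum_nonneg fun x hx => mul_nonneg (hμ' x hx) <|
    Finset.sum_nonneg fun y hy => mul_nonneg (hμ' y hy) <|
      sub_nonneg.2 (hmono _ _ Finset.subset_union_right)
  have hE0 : 0 ≤ E := Finset.sum_nonneg fun y hy => mul_nonneg (hμ' y hy) (sub_nonneg.2 (hq _))
  have hER : E ≤ q - F S := by
    calc E ≤ ∑ y ∈ s, μ y / M * (q - F S) := by
          refine Finset.sum_le_sum fun y hy => mul_le_mul_of_nonneg_left ?_ (hμ' y hy)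
          linarith [hmono _ _ (hS y hy)]
      _ = q - F S := by rw [← Finset.sum_mul, hμ1, one_mul]
  have main : E ^ 2 ≤ 2 * (q - F S) * G := by
    rcases hE0.eq_or_lt with h0 | h0
    · rw [← h0]
      have : 0 ≤ q - F S := sub_nonneg.2 (hq S)
      rw [zero_pow two_ne_zero]
      positivity
    · set R := q - F S with hR
      have hR0 : 0 < R := h0.trans_le hER
      -- This k makes R at most half of kE, which leaves E ≤ (k − 1)G, while k − 1 ≤ 2R/E.
      set k := ⌈2 * R / E⌉₊ with hk
      have hk1 : 2 * R / E ≤ k := Nat.le_ceil _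
      have hk2 : (k : ℝ) < 2 * R / E + 1 := Nat.ceil_lt_add_one (by positivity)
      have hkE : 2 * R ≤ k * E := (div_le_iff₀ h0).1 hk1
      have hk0 : (0 : ℝ) < k := lt_of_lt_of_le (by positivity) hk1
      have h1 := key k
      have h2 : k * E / 2 ≤ k * (k - 1) / 2 * G := by linarith
      have h3 : E ≤ (k - 1) * G := by
        have : k * E ≤ k * ((k - 1) * G) := by linarith
        exact le_of_mul_le_mul_left this hk0
      have h4 : (k - 1) * G ≤ 2 * R / E * G := by gcongr; linarith
      calc E ^ 2 = E * E := sq E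
        _ ≤ E * (2 * R / E * G) := by gcongr; linarith
        _ = 2 * R * G := by field_simp
  rw [hE', hG', mul_pow]
  calc M ^ 2 * E ^ 2 ≤ M ^ 2 * (2 * (q - F S) * G) := by gcongr
    _ = _ := by ring

end Submodular

/-! ### Progress for independent items -/

section Independent

variable {U : Type u} {m : ℕ}

theorem image_update_of_notMem [DecidableEq U] {L : Finset (Fin m)} {X : Fin m → U} {e : Fin m}
    (he : e ∉ L) (u : U) : L.image (Function.update X e u) = L.image X := by
  refine Finset.image_congr fun i hi => ?_
  exact Function.update_of_ne (ne_of_mem_of_not_mem hi he) _ _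

/-- Exchanging the realizations of one item in two samples. -/
theorem sum_sum_exchange {w : (Fin m → U) → ℝ}
    (hw : ∀ e x y, w (Function.update x e (y e)) * w (Function.update y e (x e)) = w x * w y)
    (e : Fin m) (s t : Finset (Fin m → U)) (hs : ∀ X u, Function.update X e u ∈ s ↔ X ∈ s)
    (ht : ∀ X u, Function.update X e u ∈ t ↔ X ∈ t) (g h : (Fin m → U) → ℝ)
    (k : U → (Fin m → U) → ℝ) (hg : ∀ X u, g (Function.update X e u) = g X)
    (hh : ∀ X u, h (Function.update X e u) = h X)
    (hk : ∀ v X u, k v (Function.update X e u) = k v X) :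
    ∑ x ∈ s, ∑ y ∈ t, w x * w y * (g x * h y * k (x e) y) =
      (∑ x ∈ s, w x * g x) * ∑ y ∈ t, w y * h y * k (y e) y := by
  rw [Finset.sum_mul_sum, ← Finset.sum_product', ← Finset.sum_product']
  refine Finset.sum_nbij'
    (fun p => (Function.update p.1 e (p.2 e), Function.update p.2 e (p.1 e)))
    (fun p => (Function.update p.1 e (p.2 e), Function.update p.2 e (p.1 e)))
    ?_ ?_ ?_ ?_ ?_
  · rintro ⟨x, y⟩ hp
    simpa [hs, ht] using hp
  · rintro ⟨x, y⟩ hp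
    simpa [hs, ht] using hp
  · rintro ⟨x, y⟩ _
    simp
  · rintro ⟨x, y⟩ _
    simp
  · rintro ⟨x, y⟩ _
    simp only [hg, hh, hk, Function.update_self]
    rw [← hw e x y]
    ring

variable [Fintype U]

theorem mem_agreeClass_update {T : Finset (Fin m)} {x X : Fin m → U} {e : Fin m} (he : e ∉ T)
    (u : U) : Function.update X e u ∈ agreeClass T x ↔ X ∈ agreeClass T x := by
  rw [mem_agreeClass, mem_agreeClass]
  refine forall₂_congr fun i hi => ?_
  rw [Function.update_of_ne (ne_of_mem_of_not_mem hi he)]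

variable [DecidableEq U]

open Classical in
/-- Independent items: what is left to do is the missing value of the submodular function. -/
theorem makesProgress_of_exchange {w : (Fin m → U) → ℝ} (hw0 : ∀ X, 0 ≤ w X)
    (hw : ∀ e x y, w (Function.update x e (y e)) * w (Function.update y e (x e)) = w x * w y)
    {c : Fin m → ℝ} (hc : ∀ i, 0 ≤ c i) (f : Finset U → ℕ) (hmono : ∀ A B : Finset U, A ⊆ B → f A ≤ f B)
    (hsub : ∀ A B : Finset U, f (A ∪ B) + f (A ∩ B) ≤ f A + f B)
    (A : AdaptiveSolution U m)
    (hA : ∀ X, w X ≠ 0 → f ((A.probed X).image X) = f Finset.univ) :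
    MakesProgress w (fun X => ∑ i ∈ A.probed X, c i) c
      (fun L X => f Finset.univ - f (L.image X)) (1 / 2) := by
  intro T L x δ hδ hδ1 hTL hR
  set F : Finset U → ℝ := fun A => f A with hF
  set q : ℝ := ((f Finset.univ : ℕ) : ℝ) with hq
  have hFq : ∀ A, F A ≤ q := fun A => by
    simp only [hF, hq]
    exact_mod_cast hmono _ _ (Finset.subset_univ _)
  have hFmono : ∀ A B, A ⊆ B → F A ≤ F B := fun A B h => by
    simp only [hF]
    exact_mod_cast hmono _ _ h
  have hFsub : ∀ A B, F (A ∪ B) + F (A ∩ B) ≤ F A + F B := fun A B => by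
    simp only [hF]
    exact_mod_cast hsub A B
  have hcast : ∀ (L : Finset (Fin m)) (X : Fin m → U),
      ((f Finset.univ - f (L.image X) : ℕ) : ℝ) = q - F (L.image X) := fun L X => by
    rw [Nat.cast_sub (hmono _ _ (Finset.subset_univ _))]
  have hR' : 0 < q - F (T.image x) := by
    rw [← hcast]
    exact_mod_cast hR
  simp only [hcast]
  set H := (agreeClass T x).filter fun X => δ * (q - F (T.image x)) ≤ q - F (L.image X) with hH
  set P := ∑ X ∈ H, w X with hP
  intro hPpos
  set R := q - F (T.image x) with hRdef
  have hθ : 0 < δ * R := by positivity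
  have hres : ∀ y ∈ H, 0 < q - F (L.image y) := fun y hy =>
    hθ.trans_le (Finset.mem_filter.1 hy).2
  set V : (Fin m → U) → Finset U := fun X => L.image X with hV
  set Tx : (Fin m → U) → Finset U := fun X => (A.probed X \ L).image X with hTx
  set D : U → (Fin m → U) → ℝ := fun u y => F (insert u (V y)) - F (V y) with hD
  have hD0 : ∀ u y, 0 ≤ D u y := fun u y => sub_nonneg.2 (hFmono _ _ (Finset.subset_insert _ _))
  set p : Fin m → ℝ := fun e => ∑ X ∈ agreeClass T x, w X * if e ∈ A.probed X then 1 else 0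
    with hp
  set score : Fin m → ℝ := fun e => ∑ y ∈ H, w y * (1 / (q - F (V y))) * D (y e) y with hscore
  have hp0 : ∀ e, 0 ≤ p e := fun e => Finset.sum_nonneg fun X _ =>
    mul_nonneg (hw0 X) (by split_ifs <;> norm_num)
  -- Dividing the weights by the residual makes the left-hand side P² and turns gains on y into
  -- relative gains. Residuals on H are at least δR, so the weights of the other sample cost only a
  -- factor 1/(δR).
  have hpairs := submodular_pairs hFmono hFsub H (μ := fun X => w X * (1 / (q - F (V X))))
    (fun y hy => mul_nonneg (hw0 y) (one_div_nonneg.2 (hres y hy).le)) V Tx hFq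
    (fun X hX h => by
      refine le_antisymm (hFq _) ?_
      have h1 : F ((A.probed X).image X) = q := by
        simp only [hF, hq]
        exact_mod_cast hA X fun h0 => h (by simp [h0])
      rw [← h1]
      refine hFmono _ _ ?_
      rw [hTx, hV, ← Finset.image_union]
      refine Finset.image_subset_image fun i hi => ?_
      by_cases hiL : i ∈ L <;> simp [hi, hiL])
    (S := T.image x)
    (fun y hy => by
      have h1 := mem_agreeClass.1 (Finset.mem_filter.1 hy).1
      have h2 : T.image x = T.image y := Finset.image_congr fun i hi => (h1 i hi).symm
      rw [h2]
      exact Finset.image_subset_image hTL)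
  have hE : ∑ y ∈ H, w y * (1 / (q - F (V y))) * (q - F (V y)) = P :=
    Finset.sum_congr rfl fun y hy => by
      have := (hres y hy).ne'
      rw [mul_assoc, one_div, inv_mul_cancel₀ this, mul_one]
  rw [hE, ← hRdef] at hpairs
  have hscore_sum : δ / 2 * P ^ 2 ≤ ∑ e ∈ Finset.univ \ L, p e * score e := by
    have hinner : ∀ z ∈ agreeClass T x,
        0 ≤ ∑ y ∈ H, w y * (1 / (q - F (V y))) * (F (Tx z ∪ V y) - F (V y)) :=
      fun z _ => Finset.sum_nonneg fun y hy => mul_nonneg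
        (mul_nonneg (hw0 y) (one_div_nonneg.2 (hres y hy).le))
        (sub_nonneg.2 (hFmono _ _ Finset.subset_union_right))
    have h1 : ∑ z ∈ H, w z * (1 / (q - F (V z))) *
        ∑ y ∈ H, w y * (1 / (q - F (V y))) * (F (Tx z ∪ V y) - F (V y)) ≤
        1 / (δ * R) * ∑ z ∈ agreeClass T x, w z *
          ∑ y ∈ H, w y * (1 / (q - F (V y))) * (F (Tx z ∪ V y) - F (V y)) := by
      rw [Finset.mul_sum]
      refine le_trans (Finset.sum_le_sum fun z hz => ?_) (Finset.sum_le_sum_of_subset_of_nonneg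
        (Finset.filter_subset _ _) fun z hz _ => mul_nonneg (by positivity)
          (mul_nonneg (hw0 z) (hinner z hz)))
      have hz' := Finset.mem_filter.1 hz
      have h2 : 1 / (q - F (V z)) ≤ 1 / (δ * R) := one_div_le_one_div_of_le hθ hz'.2
      calc _ = 1 / (q - F (V z)) * (w z *
            ∑ y ∈ H, w y * (1 / (q - F (V y))) * (F (Tx z ∪ V y) - F (V y))) := by ring
        _ ≤ _ := mul_le_mul_of_nonneg_right h2 (mul_nonneg (hw0 z) (hinner z hz'.1))
    have h2 : ∑ z ∈ agreeClass T x, w z *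
        ∑ y ∈ H, w y * (1 / (q - F (V y))) * (F (Tx z ∪ V y) - F (V y)) ≤
        ∑ e ∈ Finset.univ \ L, p e * score e := by
      -- For e outside L nothing but the marginal gain sees the value of e: neither the event that
      -- `A` probes e, nor the classes, nor V. So the value may be taken from y instead of z, and
      -- the double sum factors.
      have h3 : ∀ e ∈ Finset.univ \ L, p e * score e =
          ∑ z ∈ agreeClass T x, ∑ y ∈ H, w z * w y *
            ((if e ∈ A.probed z then 1 else 0) * (1 / (q - F (V y))) * D (z e) y) := by
        intro e he
        have he' : e ∉ L := (Finset.mem_sdiff.1 he).2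
        have hVu : ∀ y u, V (Function.update y e u) = V y := fun y u =>
          image_update_of_notMem he' u
        rw [sum_sum_exchange hw e (agreeClass T x) H
          (fun X u => mem_agreeClass_update (fun h => he' (hTL h)) u)
          (fun X u => by
            rw [hH, Finset.mem_filter, Finset.mem_filter,
              mem_agreeClass_update (fun h => he' (hTL h)) u, image_update_of_notMem he'])
          (fun X => if e ∈ A.probed X then 1 else 0) (fun y => 1 / (q - F (V y))) D
          (fun X u => by simp only [A.mem_probed_update])
          (fun X u => by simp only [hVu])
          (fun v X u => by simp only [hD, hVu])]
      rw [Finset.sum_congr rfl h3, Finset.sum_comm]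
      refine Finset.sum_le_sum fun z _ => ?_
      rw [Finset.sum_comm, Finset.mul_sum]
      refine Finset.sum_le_sum fun y hy => ?_
      have h4 := submodular_image_le_sum hFmono hFsub (V y) (A.probed z \ L) z
      have h5 : ∑ e ∈ A.probed z \ L, D (z e) y =
          ∑ e ∈ Finset.univ \ L, (if e ∈ A.probed z then 1 else 0) * D (z e) y := by
        simp only [ite_mul, one_mul, zero_mul]
        rw [← Finset.sum_filter]
        refine Finset.sum_congr ?_ fun _ _ => rfl
        ext i
        simp [and_comm]
      calc w z * (w y * (1 / (q - F (V y))) * (F (Tx z ∪ V y) - F (V y)))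
          ≤ w z * (w y * (1 / (q - F (V y))) * ∑ e ∈ A.probed z \ L, D (z e) y) := by
            refine mul_le_mul_of_nonneg_left (mul_le_mul_of_nonneg_left h4 ?_) (hw0 z)
            exact mul_nonneg (hw0 y) (one_div_nonneg.2 (hres y hy).le)
        _ = _ := by
            rw [h5, Finset.mul_sum, Finset.mul_sum]
            exact Finset.sum_congr rfl fun e _ => by ring
    have h6 : P ^ 2 ≤ 2 * R * (1 / (δ * R) * ∑ e ∈ Finset.univ \ L, p e * score e) :=
      hpairs.trans (mul_le_mul_of_nonneg_left
        (h1.trans (mul_le_mul_of_nonneg_left h2 (by positivity))) (by positivity))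
    have h7 : 2 * R * (1 / (δ * R) * ∑ e ∈ Finset.univ \ L, p e * score e) =
        2 / δ * ∑ e ∈ Finset.univ \ L, p e * score e := by
      field_simp
    rw [h7] at h6
    calc δ / 2 * P ^ 2 ≤ δ / 2 * (2 / δ * ∑ e ∈ Finset.univ \ L, p e * score e) := by gcongr
      _ = _ := by field_simp
  set O := ∑ X ∈ agreeClass T x, w X * ∑ i ∈ A.probed X, c i with hO
  have hκ : 0 < δ / 2 * P ^ 2 := by positivity
  have hpc : ∑ e ∈ Finset.univ \ L, p e * c e ≤ O := by
    calc ∑ e ∈ Finset.univ \ L, p e * c e ≤ ∑ e, p e * c e :=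
          Finset.sum_le_sum_of_subset_of_nonneg (Finset.subset_univ _)
            fun e _ _ => mul_nonneg (hp0 e) (hc e)
      _ = O := by
          simp only [hp, Finset.sum_mul]
          rw [Finset.sum_comm, hO]
          refine Finset.sum_congr rfl fun X _ => ?_
          simp only [mul_assoc, ite_mul, one_mul, zero_mul, mul_ite, mul_zero]
          rw [← Finset.sum_filter, Finset.mul_sum]
          exact Finset.sum_congr (by ext i; simp) fun _ _ => rfl
  have hO0 : 0 ≤ O :=
    (Finset.sum_nonneg fun e _ => mul_nonneg (hp0 e) (hc e)).trans hpc
  have hscore0 : ∀ e, 0 ≤ score e := fun e => Finset.sum_nonneg fun y hy => mul_nonneg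
    (mul_nonneg (hw0 y) (one_div_nonneg.2 (hres y hy).le)) (hD0 _ _)
  -- If every item with positive score were too expensive, weighting by p would contradict Σ p c ≤ O
  -- and Σ p · score ≥ δP²/2.
  obtain ⟨e, hes, hec⟩ : ∃ e, 0 < score e ∧ δ / 2 * P ^ 2 * c e ≤ O * score e := by
    by_contra! hcon
    have hle : ∀ e ∈ Finset.univ \ L, p e * score e * O ≤ p e * (δ / 2 * P ^ 2 * c e) := by
      intro e _
      rw [mul_assoc]
      refine mul_le_mul_of_nonneg_left ?_ (hp0 e)
      rcases (hscore0 e).eq_or_lt with h | h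
      · rw [← h, zero_mul]
        exact mul_nonneg hκ.le (hc e)
      · rw [mul_comm]
        exact (hcon e h).le
    have hlt : ∃ e ∈ Finset.univ \ L, p e * score e * O < p e * (δ / 2 * P ^ 2 * c e) := by
      obtain ⟨e, he, hpos⟩ := Finset.exists_lt_of_sum_lt
        (s := Finset.univ \ L) (f := fun _ => (0 : ℝ)) (g := fun e => p e * score e)
        (by simpa using hκ.trans_le hscore_sum)
      have hpe : 0 < p e := (hp0 e).lt_of_ne fun h => by simp [← h] at hpos
      have hse : 0 < score e := (hscore0 e).lt_of_ne fun h => by simp [← h] at hpos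
      refine ⟨e, he, ?_⟩
      rw [mul_assoc, mul_comm (score e)]
      exact mul_lt_mul_of_pos_left (hcon e hse) hpe
    have hsum := Finset.sum_lt_sum hle hlt
    rw [← Finset.sum_mul] at hsum
    have h1 : ∑ e ∈ Finset.univ \ L, p e * (δ / 2 * P ^ 2 * c e) =
        δ / 2 * P ^ 2 * ∑ e ∈ Finset.univ \ L, p e * c e := by
      rw [Finset.mul_sum]
      exact Finset.sum_congr rfl fun e _ => by ring
    have h2 := mul_le_mul_of_nonneg_left hpc hκ.le
    have h3 := mul_le_mul_of_nonneg_right hscore_sum hO0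
    linarith
  have hdrop : ∑ X ∈ H, w X * ((q - F (L.image X) - (q - F ((L ∪ {e}).image X))) /
      (q - F (L.image X))) = score e := by
    refine Finset.sum_congr rfl fun X _ => ?_
    simp only [hD, hV, Finset.image_union, Finset.image_singleton]
    rw [Finset.union_comm, Finset.singleton_union]
    ring
  refine ⟨{e}, ?_, ?_⟩
  · rw [hdrop]
    exact hes
  · rw [hdrop, Finset.sum_singleton]
    linarith

end Independent

/-! ### Progress for arbitrary joint distributions -/

section Scenario

variable {U : Type u} {m : ℕ}

open Classical in
/-- The number of realizations in `s` that agree with `X` on the items in `L`, or `0` if these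
items cover. -/
noncomputable def scenarioRank (s : Finset (Fin m → U)) (cov : Finset (Fin m) → (Fin m → U) → Prop)
    (L : Finset (Fin m)) (X : Fin m → U) : ℕ :=
  if cov L X then 0 else {Y ∈ s | observed L Y = observed L X}.card

theorem scenarioRank_anti (s : Finset (Fin m → U)) {cov : Finset (Fin m) → (Fin m → U) → Prop}
    (hcov : ∀ S T X, S ⊆ T → cov S X → cov T X) {S T : Finset (Fin m)} {X : Fin m → U}
    (h : S ⊆ T) : scenarioRank s cov T X ≤ scenarioRank s cov S X := by
  classical
  by_cases hT : cov T X
  · simp [scenarioRank, hT]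
  · have hS : ¬ cov S X := fun hS => hT (hcov S T X h hS)
    simp only [scenarioRank, hT, hS, if_false]
    refine Finset.card_le_card fun Y hY => ?_
    rw [Finset.mem_filter, observed_self_eq_iff] at hY ⊢
    exact ⟨hY.1, fun i hi => hY.2 i (h hi)⟩

theorem scenarioRank_congr (s : Finset (Fin m → U)) {cov : Finset (Fin m) → (Fin m → U) → Prop}
    (hcov : ∀ S X Y, (∀ i ∈ S, X i = Y i) → cov S X → cov S Y) {S : Finset (Fin m)}
    {X Y : Fin m → U} (h : ∀ i ∈ S, X i = Y i) : scenarioRank s cov S X = scenarioRank s cov S Y := by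
  classical
  have h1 : cov S X ↔ cov S Y := ⟨hcov S X Y h, hcov S Y X fun i hi => (h i hi).symm⟩
  simp only [scenarioRank, h1, observed_self_eq_iff.2 h]

theorem scenarioRank_le_card (s : Finset (Fin m → U))
    (cov : Finset (Fin m) → (Fin m → U) → Prop) (S : Finset (Fin m)) (X : Fin m → U) :
    scenarioRank s cov S X ≤ s.card := by
  classical
  rw [scenarioRank]
  split_ifs
  · exact Nat.zero_le _
  · exact Finset.card_le_card (Finset.filter_subset _ _)

theorem cov_of_scenarioRank_eq_zero {s : Finset (Fin m → U)}
    {cov : Finset (Fin m) → (Fin m → U) → Prop} {S : Finset (Fin m)} {X : Fin m → U} (hX : X ∈ s)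
    (h : scenarioRank s cov S X = 0) : cov S X := by
  classical
  by_contra hc
  rw [scenarioRank, if_neg hc, Finset.card_eq_zero] at h
  exact Finset.notMem_empty X (h ▸ Finset.mem_filter.2 ⟨hX, rfl⟩)

theorem sum_biUnion_le_card_mul {ι : Type*} {c : Fin m → ℝ} (hc : ∀ i, 0 ≤ c i) (s : Finset ι)
    (S : ι → Finset (Fin m)) {k : ℝ} (hk : ∀ o ∈ s, ∑ i ∈ S o, c i ≤ k) :
    ∑ i ∈ s.biUnion S, c i ≤ s.card * k := by
  classical
  induction s using Finset.induction_on with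
  | empty => simp
  | insert o s ho ih =>
    rw [Finset.biUnion_insert, Finset.card_insert_of_notMem ho]
    have h1 := ih fun o' ho' => hk o' (Finset.mem_insert_of_mem ho')
    have h2 := hk o (Finset.mem_insert_self _ _)
    have h3 := Finset.sum_union_inter (s₁ := S o) (s₂ := s.biUnion S) (f := c)
    have h4 := Finset.sum_nonneg fun i (_ : i ∈ S o ∩ s.biUnion S) => hc i
    push_cast
    linarith

variable [Fintype U]

open Classical in
/-- Arbitrary joint distributions: what is left to do is to single out the scenario. -/
theorem makesProgress_scenario {w : (Fin m → U) → ℝ} (hw : ∀ X, 0 ≤ w X) {c : Fin m → ℝ}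
    (hc : ∀ i, 0 ≤ c i) {cov : Finset (Fin m) → (Fin m → U) → Prop}
    (hcov : ∀ S T X, S ⊆ T → cov S X → cov T X)
    (A : AdaptiveSolution U m) (hA : ∀ X, w X ≠ 0 → cov (A.probed X) X) :
    MakesProgress w (fun X => ∑ i ∈ A.probed X, c i) c
      (scenarioRank (Finset.univ.filter fun X => w X ≠ 0) cov) (1 / 8) := by
  intro T L x δ hδ hδ1 hTL hR
  set s : Finset (Fin m → U) := Finset.univ.filter fun X => w X ≠ 0 with hs
  set ρ := scenarioRank s cov with hρ
  have hR' : (0 : ℝ) < ρ T x := by exact_mod_cast hR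
  set H := (agreeClass T x).filter fun X => δ * ρ T x ≤ ρ L X with hH
  set P := ∑ X ∈ H, w X with hP
  intro hPpos
  set O := ∑ X ∈ agreeClass T x, w X * ∑ i ∈ A.probed X, c i with hO
  have ha : ∀ X, 0 ≤ ∑ i ∈ A.probed X, c i := fun X => Finset.sum_nonneg fun i _ => hc i
  have hO0 : 0 ≤ O := Finset.sum_nonneg fun X _ => mul_nonneg (hw X) (ha X)
  -- By Markov's inequality, `A` exceeds this budget on at most half of the weight of H.
  set k := 2 * O / P with hk
  have hk0 : 0 ≤ k := by positivity
  have hθ : 0 < δ * ρ T x := by positivity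
  have hρL : ∀ X ∈ H, 0 < ρ L X := fun X hX => by
    have := hθ.trans_le (Finset.mem_filter.1 hX).2
    exact_mod_cast this
  have hρcard : ∀ (S : Finset (Fin m)) X, 0 < ρ S X →
      ρ S X = {Y ∈ s | observed S Y = observed S X}.card := fun S X h => by
    rw [hρ, scenarioRank] at h ⊢
    split_ifs at h ⊢
    · omega
    · rfl
  set C := H.image fun X => observed L X with hC
  -- Distinct observations in C have disjoint sets of compatible scenarios, each of size at least δ
  -- ρ(T, x), inside a set of size ρ(T, x).
  have hCcard : (C.card : ℝ) ≤ 1 / δ := by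
    have h1 : ∀ o ∈ C, δ * ρ T x ≤
        ((({Y ∈ s | observed T Y = observed T x ∧ observed L Y ∈ C}.filter
          fun Y => observed L Y = o).card : ℕ) : ℝ) := by
      intro o ho
      obtain ⟨X, hX, rfl⟩ := Finset.mem_image.1 ho
      refine (Finset.mem_filter.1 hX).2.trans ?_
      rw [hρcard L X (hρL X hX)]
      refine Nat.cast_le.2 (Finset.card_le_card fun Y hY => ?_)
      rw [Finset.mem_filter] at hY
      have hXT := mem_agreeClass.1 (Finset.mem_filter.1 hX).1
      have hYX := observed_self_eq_iff.1 hY.2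
      rw [Finset.mem_filter, Finset.mem_filter, observed_self_eq_iff]
      refine ⟨⟨hY.1, fun i hi => (hYX i (hTL hi)).trans (hXT i hi), ?_⟩, hY.2⟩
      rw [hY.2]
      exact ho
    have h2 := Finset.card_eq_sum_card_fiberwise
      (s := {Y ∈ s | observed T Y = observed T x ∧ observed L Y ∈ C}) (t := C)
      (f := fun Y => observed L Y) (fun Y hY => by
        have := (Finset.mem_filter.1 (Finset.mem_coe.1 hY)).2.2
        exact this)
    have h3 : {Y ∈ s | observed T Y = observed T x ∧ observed L Y ∈ C}.card ≤ ρ T x := by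
      rw [hρcard T x hR]
      refine Finset.card_le_card fun Y hY => ?_
      rw [Finset.mem_filter] at hY ⊢
      exact ⟨hY.1, hY.2.1⟩
    have h4 := Finset.sum_le_sum h1
    rw [Finset.sum_const, nsmul_eq_mul, ← Nat.cast_sum, ← h2] at h4
    have h5 : (C.card : ℝ) * (δ * ρ T x) ≤ ρ T x := h4.trans (by exact_mod_cast h3)
    rw [le_div_iff₀ hδ]
    have h6 : (C.card : ℝ) * δ * ρ T x ≤ 1 * ρ T x := by linarith
    exact le_of_mul_le_mul_right h6 hR'
  -- A most frequent value of each item separately; the resulting assignment `b o` need not be a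
  -- scenario.
  have hmode : ∀ (o : Fin m → Option U) (e : Fin m), ∃ v : U, ∀ u : U,
      {Y ∈ s | observed L Y = o ∧ Y e = u}.card ≤ {Y ∈ s | observed L Y = o ∧ Y e = v}.card := by
    intro o e
    obtain ⟨v, -, hv⟩ := Finset.exists_max_image (Finset.univ : Finset U)
      (fun u => {Y ∈ s | observed L Y = o ∧ Y e = u}.card) ⟨x e, Finset.mem_univ _⟩
    exact ⟨v, fun u => hv u (Finset.mem_univ _)⟩
  choose b hb using hmode
  set N := C.biUnion fun o => (A.truncate c k).probed (b o) with hN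
  have hcN : ∑ i ∈ N, c i ≤ 1 / δ * k :=
    (sum_biUnion_le_card_mul hc C _ fun o _ => A.sum_truncate_le (b o) c k hk0).trans
      (mul_le_mul_of_nonneg_right hCcard hk0)
  have hdrop0 : ∀ X ∈ H, 0 ≤ ((ρ L X : ℝ) - ρ (L ∪ N) X) / ρ L X := fun X _ => by
    have : (ρ (L ∪ N) X : ℝ) ≤ ρ L X := by
      exact_mod_cast scenarioRank_anti s hcov Finset.subset_union_left
    exact div_nonneg (by linarith) (Nat.cast_nonneg _)
  -- If X agrees with the path of modes, N contains everything `A` probes on X, and the rank drops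
  -- to 0. Otherwise X has a non-modal value at some probed e, shared by at most half of the
  -- compatible scenarios.
  have hhalf : ∀ X ∈ H, w X ≠ 0 → ∑ i ∈ A.probed X, c i ≤ k → 2 * ρ (L ∪ N) X ≤ ρ L X := by
    intro X hX hwX haX
    have hstem : (A.truncate c k).probed (b (observed L X)) ⊆ N := by
      rw [hN]
      exact Finset.subset_biUnion_of_mem (fun o => (A.truncate c k).probed (b o))
        (Finset.mem_image_of_mem _ hX)
    by_cases hag : ∀ i ∈ (A.truncate c k).probed (b (observed L X)), X i = b (observed L X) i
    · have h1 := (A.truncate c k).probed_congr hag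
      rw [A.truncate_probed X c k hc haX] at h1
      have h2 : cov (L ∪ N) X :=
        hcov _ _ X ((h1 ▸ hstem).trans Finset.subset_union_right) (hA X hwX)
      have h3 : ρ (L ∪ N) X = 0 := by
        rw [hρ, scenarioRank, if_pos h2]
      omega
    · push Not at hag
      obtain ⟨e, he, hne⟩ := hag
      have h1 : ρ (L ∪ N) X ≤ {Y ∈ s | observed L Y = observed L X ∧ Y e = X e}.card := by
        rcases Nat.eq_zero_or_pos (ρ (L ∪ N) X) with h0 | h0
        · omega
        rw [hρcard _ X h0]
        refine Finset.card_le_card fun Y hY => ?_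
        rw [Finset.mem_filter, observed_self_eq_iff] at hY
        rw [Finset.mem_filter, observed_self_eq_iff]
        exact ⟨hY.1, fun i hi => hY.2 i (Finset.mem_union_left _ hi),
          hY.2 e (Finset.mem_union_right _ (hstem he))⟩
      have h2 := hb (observed L X) e (X e)
      have h3 : {Y ∈ s | observed L Y = observed L X ∧ Y e = X e}.card +
          {Y ∈ s | observed L Y = observed L X ∧ Y e = b (observed L X) e}.card ≤ ρ L X := by
        rw [hρcard L X (hρL X hX), ← Finset.card_union_of_disjoint]
        · refine Finset.card_le_card fun Y hY => ?_
          simp only [Finset.mem_union, Finset.mem_filter] at hY ⊢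
          tauto
        · rw [Finset.disjoint_left]
          intro Y hY hY'
          rw [Finset.mem_filter] at hY hY'
          exact hne (hY.2.2.symm.trans hY'.2.2)
      omega
  have hmarkov : ∑ X ∈ H with ¬ ∑ i ∈ A.probed X, c i ≤ k, w X ≤ P / 2 := by
    by_contra hcon
    rw [not_le] at hcon
    have h1 : ∑ X ∈ H with ¬ ∑ i ∈ A.probed X, c i ≤ k, w X * k <
        ∑ X ∈ H with ¬ ∑ i ∈ A.probed X, c i ≤ k, w X * ∑ i ∈ A.probed X, c i := by
      refine Finset.sum_lt_sum (fun X hX => ?_) ?_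
      · exact mul_le_mul_of_nonneg_left (not_le.1 (Finset.mem_filter.1 hX).2).le (hw X)
      · obtain ⟨X, hX, hpos⟩ := Finset.exists_lt_of_sum_lt
          (s := H.filter fun X => ¬ ∑ i ∈ A.probed X, c i ≤ k) (f := fun _ => (0 : ℝ)) (g := w)
          (by
            rw [Finset.sum_const_zero]
            linarith)
        exact ⟨X, hX, mul_lt_mul_of_pos_left (not_le.1 (Finset.mem_filter.1 hX).2) hpos⟩
    have h2 : ∑ X ∈ H with ¬ ∑ i ∈ A.probed X, c i ≤ k, w X * ∑ i ∈ A.probed X, c i ≤ O :=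
      Finset.sum_le_sum_of_subset_of_nonneg
        ((Finset.filter_subset _ _).trans (Finset.filter_subset _ _))
        fun X _ _ => mul_nonneg (hw X) (ha X)
    rw [← Finset.sum_mul] at h1
    have h3 : P / 2 * k = O := by
      rw [hk]
      field_simp
    have h4 := mul_le_mul_of_nonneg_right hcon.le hk0
    linarith
  have hdrop : P / 4 ≤ ∑ X ∈ H, w X * (((ρ L X : ℝ) - ρ (L ∪ N) X) / ρ L X) := by
    have h1 := Finset.sum_filter_add_sum_filter_not H (fun X => ∑ i ∈ A.probed X, c i ≤ k) w
    have h2 : ∑ X ∈ H with ∑ i ∈ A.probed X, c i ≤ k, w X * (1 / 2) ≤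
        ∑ X ∈ H, w X * (((ρ L X : ℝ) - ρ (L ∪ N) X) / ρ L X) := by
      refine le_trans (Finset.sum_le_sum fun X hX => ?_) (Finset.sum_le_sum_of_subset_of_nonneg
        (Finset.filter_subset _ _) fun X hX _ => mul_nonneg (hw X) (hdrop0 X hX))
      by_cases hwX : w X = 0
      · simp [hwX]
      refine mul_le_mul_of_nonneg_left ?_ (hw X)
      obtain ⟨hX1, hX2⟩ := Finset.mem_filter.1 hX
      have h3 : (2 : ℝ) * ρ (L ∪ N) X ≤ ρ L X := by exact_mod_cast hhalf X hX1 hwX hX2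
      have h4 : (0 : ℝ) < ρ L X := by exact_mod_cast hρL X hX1
      rw [le_div_iff₀ h4]
      linarith
    rw [← Finset.sum_mul] at h2
    linarith
  refine ⟨N, by linarith, ?_⟩
  calc 1 / 8 * δ * P ^ 2 * ∑ i ∈ N, c i ≤ 1 / 8 * δ * P ^ 2 * (1 / δ * k) := by gcongr
    _ = O * (P / 4) := by
      rw [hk]
      field_simp
      ring
    _ ≤ _ := mul_le_mul_of_nonneg_left hdrop hO0

end Scenario

/-! ### Choice of parameters and conclusion -/

/-- The number of rounds that are worth playing. -/
theorem exists_num_rounds (n r : ℕ) (hn : 1 ≤ n) (hr : 1 ≤ r) : ∃ r' : ℕ, 1 ≤ r' ∧ r' ≤ r ∧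
    (n : ℝ) ^ (1 / (r' : ℝ)) * (r' + Real.log n) ≤
      12 * max 1 ((n : ℝ) ^ (1 / (r : ℝ)) * Real.log n) := by
  rcases hn.eq_or_lt with h1 | h1
  · refine ⟨1, le_rfl, hr, ?_⟩
    rw [← h1]
    simp
  have hn2 : (2 : ℝ) ≤ n := by exact_mod_cast h1
  have hn0 : (0 : ℝ) < n := by linarith
  have hlog : 1 / 2 < Real.log n := by
    have := Real.log_le_log two_pos hn2
    linarith [Real.log_two_gt_d9]
  have hceil0 : 1 ≤ ⌈Real.log n⌉₊ := Nat.one_le_ceil_iff.2 (by linarith)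
  have hceil : (⌈Real.log n⌉₊ : ℝ) < Real.log n + 1 := Nat.ceil_lt_add_one (by linarith)
  have hpow : (1 : ℝ) ≤ (n : ℝ) ^ (1 / (r : ℝ)) :=
    Real.one_le_rpow (by linarith) (by positivity)
  -- Past log n rounds n^(1/r') is already at most e < 3, while r' would dominate log n. Since 1 < 2
  -- log n for n ≥ 2, the constant is 3 · 4.
  refine ⟨min r ⌈Real.log n⌉₊, le_min hr hceil0, min_le_left _ _, ?_⟩
  have h2 : ((min r ⌈Real.log n⌉₊ : ℕ) : ℝ) + Real.log n ≤ 4 * Real.log n := by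
    have : ((min r ⌈Real.log n⌉₊ : ℕ) : ℝ) ≤ ⌈Real.log n⌉₊ := by
      exact_mod_cast min_le_right _ _
    linarith
  have h3 : (n : ℝ) ^ (1 / ((min r ⌈Real.log n⌉₊ : ℕ) : ℝ)) ≤
      3 * (n : ℝ) ^ (1 / (r : ℝ)) := by
    rcases min_choice r ⌈Real.log n⌉₊ with h | h
    · rw [h]
      linarith
    · rw [h]
      have h4 : (n : ℝ) ^ (1 / (⌈Real.log n⌉₊ : ℝ)) ≤ 3 := by
        rw [Real.rpow_def_of_pos hn0]
        have h5 : Real.log n * (1 / (⌈Real.log n⌉₊ : ℝ)) ≤ 1 := by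
          rw [mul_one_div]
          exact div_le_one_of_le₀ (Nat.le_ceil _) (Nat.cast_nonneg _)
        exact (Real.exp_le_exp.2 h5).trans Real.exp_one_lt_three.le
      linarith
  calc _ ≤ (3 * (n : ℝ) ^ (1 / (r : ℝ))) * (4 * Real.log n) :=
        mul_le_mul h3 h2 (by positivity) (by positivity)
    _ = 12 * ((n : ℝ) ^ (1 / (r : ℝ)) * Real.log n) := by ring
    _ ≤ _ := by
        gcongr
        exact le_max_right _ _

namespace CoverInstance

variable {U : Type u} [Fintype U] [DecidableEq U] {m : ℕ} (I : CoverInstance U m)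

theorem sum_toReal_D : ∑ X, (I.D X).toReal = 1 := by
  rw [← ENNReal.toReal_sum fun X _ => I.D.apply_ne_top X, ← tsum_fintype (L := .unconditional _),
    I.D.tsum_coe, ENNReal.toReal_one]

theorem toReal_D_ne_zero {X : Fin m → U} : (I.D X).toReal ≠ 0 ↔ X ∈ I.D.support := by
  rw [ENNReal.toReal_ne_zero, PMF.mem_support_iff]
  exact and_iff_left (I.D.apply_ne_top X)

theorem Covers.mono {I : CoverInstance U m} {S T : Finset (Fin m)} {X : Fin m → U}
    (hS : I.Covers S X) (h : S ⊆ T) : I.Covers T X := by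
  refine le_antisymm (I.f_mono _ _ (Finset.subset_univ _)) ?_
  rw [← (hS : I.f (S.image X) = I.Q)]
  exact I.f_mono _ _ (Finset.image_subset_image h)

/-- The optimum is attained. -/
theorem exists_optimal (h : I.Feasible) : ∃ A : AdaptiveSolution U m,
    (∀ X ∈ I.D.support, I.Covers (A.probed X) X) ∧
      I.OPT = I.expect fun X => I.setCost (A.probed X) := by
  -- There are infinitely many trees, but the cost depends only on the map from realizations to
  -- probed sets, of which there are finitely many.
  have hfin : {v | ∃ A : AdaptiveSolution U m, (∀ X ∈ I.D.support, I.Covers (A.probed X) X) ∧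
      v = I.expect fun X => I.setCost (A.probed X)}.Finite := by
    refine (Set.finite_range fun g : (Fin m → U) → Finset (Fin m) =>
      I.expect fun X => I.setCost (g X)).subset ?_
    rintro v ⟨A, -, rfl⟩
    exact ⟨A.probed, rfl⟩
  have hne : {v | ∃ A : AdaptiveSolution U m, (∀ X ∈ I.D.support, I.Covers (A.probed X) X) ∧
      v = I.expect fun X => I.setCost (A.probed X)}.Nonempty := by
    refine ⟨_, AdaptiveSolution.ofList (List.finRange m), ?_, rfl⟩
    intro X hX
    rw [AdaptiveSolution.ofList_probed, List.toFinset_finRange]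
    exact h X hX
  exact hne.csInf_mem hfin

theorem setCost_nonneg (S : Finset (Fin m)) : 0 ≤ I.setCost S :=
  Finset.sum_nonneg fun i _ => I.cost_nonneg i

theorem OPT_nonneg (h : I.Feasible) : 0 ≤ I.OPT := by
  obtain ⟨A, -, hA⟩ := I.exists_optimal h
  rw [hA]
  exact Finset.sum_nonneg fun X _ => mul_nonneg ENNReal.toReal_nonneg (I.setCost_nonneg _)

/-- With δ = n^(-1/r') and ε = η/r', the r' rounds cost (4/κ)(r'/η) n^(1/r') (r' + log n) OPT. The
choice of r' in `exists_num_rounds` contributes the factor 12 in 48. -/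
theorem exists_solution_of_makesProgress {A : AdaptiveSolution U m}
    (hA : I.OPT = I.expect fun X => I.setCost (A.probed X))
    {ρ : Finset (Fin m) → (Fin m → U) → ℕ} {κ : ℝ} (hκ : 0 < κ)
    (h : MakesProgress (fun X => (I.D X).toReal) (fun X => ∑ i ∈ A.probed X, I.cost i) I.cost ρ κ)
    (hρ : ∀ S T X, S ⊆ T → ρ T X ≤ ρ S X)
    (hρ' : ∀ S X Y, (∀ i ∈ S, X i = Y i) → ρ S X = ρ S Y)
    (hcov : ∀ S, ∀ X ∈ I.D.support, ρ S X = 0 → I.Covers S X)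
    {n : ℕ} (hn1 : 1 ≤ n) (hn : ∀ X, ρ ∅ X ≤ n) {r : ℕ} {η : ℝ} (hr : 1 ≤ r) (hη : 0 < η) :
    ∃ B : SetBasedSolution U m r,
      I.setBasedCost B ≤
        48 / κ * (r / η) * max 1 ((n : ℝ) ^ (1 / (r : ℝ)) * Real.log n) * I.OPT ∧
      1 - η ≤ I.coverProb B := by
  classical
  obtain ⟨r', hr1, hr', hnum⟩ := exists_num_rounds n r hn1 hr
  have hn0 : (0 : ℝ) < n := by exact_mod_cast hn1
  have hn1' : (1 : ℝ) ≤ n := by exact_mod_cast hn1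
  have hr0 : (0 : ℝ) < r' := by exact_mod_cast hr1
  have hw : ∀ X, 0 ≤ (I.D X).toReal := fun X => ENNReal.toReal_nonneg
  set δ : ℝ := ((n : ℝ) ^ (1 / (r' : ℝ)))⁻¹ with hδ
  have hpow : (1 : ℝ) ≤ (n : ℝ) ^ (1 / (r' : ℝ)) := Real.one_le_rpow hn1' (by positivity)
  have hδ0 : 0 < δ := by positivity
  have hδn : δ ^ r' * n ≤ 1 := by
    rw [hδ, inv_pow, ← Real.rpow_mul_natCast hn0.le, one_div, inv_mul_cancel₀ hr0.ne',
      Real.rpow_one, inv_mul_cancel₀ hn0.ne']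
  obtain ⟨B, hB, hB'⟩ := h.exists_setBasedSolution hw
    (fun X => Finset.sum_nonneg fun i _ => I.cost_nonneg i) I.cost_nonneg hκ hρ hρ' hδ0
    (inv_le_one_of_one_le₀ hpow) (div_pos hη hr0) hn hr1 hr' hδn
  have hOPT : ∑ X, (I.D X).toReal * ∑ i ∈ A.probed X, I.cost i = I.OPT := hA.symm
  have hOPT0 : 0 ≤ I.OPT := by
    rw [hA]
    exact Finset.sum_nonneg fun X _ => mul_nonneg (hw X) (I.setCost_nonneg _)
  refine ⟨B, ?_, ?_⟩
  · rw [hOPT] at hB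
    change κ * δ * (η / r') * I.setBasedCost B ≤ _ at hB
    have hlog : Real.log (1 / δ) = Real.log n / r' := by
      rw [hδ, one_div, inv_inv, Real.log_rpow hn0]
      ring
    rw [hlog] at hB
    have h1 : I.setBasedCost B ≤ 4 / κ * (r' / η) *
        ((n : ℝ) ^ (1 / (r' : ℝ)) * (r' + Real.log n)) * I.OPT := by
      have h2 : 0 < κ * δ * (η / r') := by positivity
      refine le_of_mul_le_mul_left (hB.trans (le_of_eq ?_)) h2
      rw [hδ]
      have := (lt_of_lt_of_le one_pos hpow).ne'
      field_simp
    refine h1.trans ?_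
    have h3 : (r' : ℝ) ≤ r := by exact_mod_cast hr'
    have hl : 0 ≤ Real.log n := Real.log_nonneg hn1'
    calc _ ≤ 4 / κ * (r / η) *
          (12 * max 1 ((n : ℝ) ^ (1 / (r : ℝ)) * Real.log n)) * I.OPT := by gcongr
      _ = _ := by ring
  · rw [I.sum_toReal_D] at hB'
    have h1 : (r' : ℝ) * (η / r') * 1 = η := by field_simp
    rw [h1] at hB'
    have h2 : 1 - ∑ X with ρ (B.probed X) X ≠ 0, (I.D X).toReal ≤ I.coverProb B := by
      rw [← I.sum_toReal_D, Finset.sum_filter, ← Finset.sum_sub_distrib]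
      refine Finset.sum_le_sum fun X _ => ?_
      by_cases hX : (I.D X).toReal = 0
      · simp [hX]
      by_cases h0 : ρ (B.probed X) X = 0
      · simp [h0, hcov _ X (I.toReal_D_ne_zero.1 hX) h0]
      · simp only [ne_eq, h0, not_false_eq_true, if_true, sub_self]
        exact mul_nonneg (hw X) (by split_ifs <;> norm_num)
    linarith

/-- Exchanging one coordinate only permutes the factors of the two products. This symmetry is all
that the proof uses of independence. -/
theorem Independent.exchange {I : CoverInstance U m} (h : I.Independent) (e : Fin m)
    (x y : Fin m → U) :
    (I.D (Function.update x e (y e))).toReal * (I.D (Function.update y e (x e))).toReal =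
      (I.D x).toReal * (I.D y).toReal := by
  rw [← ENNReal.toReal_mul, ← ENNReal.toReal_mul, h, h, h x, h y, ← Finset.prod_mul_distrib,
    ← Finset.prod_mul_distrib]
  congr 1
  refine Finset.prod_congr rfl fun i _ => ?_
  by_cases hi : i = e
  · subst hi
    simp [mul_comm]
  · simp [Function.update_of_ne hi]

end CoverInstance

theorem mainTheorem11 :
    (∃ C : ℝ, 0 < C ∧
      ∀ (U : Type u) [Fintype U] [DecidableEq U] (m : ℕ) (I : CoverInstance U m),
        I.Feasible → I.Independent →
        ∀ (r : ℕ) (η : ℝ), 1 ≤ r → 0 < η →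
          ∃ B : SetBasedSolution U m r,
            I.setBasedCost B ≤
              C * (r / η) * max 1 ((I.Q : ℝ) ^ (1 / (r : ℝ)) * Real.log I.Q) * I.OPT ∧
            1 - η ≤ I.coverProb B) ∧
    (∃ C : ℝ, 0 < C ∧
      ∀ (U : Type u) [Fintype U] [DecidableEq U] (m : ℕ) (I : CoverInstance U m),
        I.Feasible →
        ∀ (r : ℕ) (η : ℝ), 1 ≤ r → 0 < η →
          ∃ B : SetBasedSolution U m r,
            I.setBasedCost B ≤
              C * (r / η) * max 1 ((I.numScenarios : ℝ) ^ (1 / (r : ℝ)) *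
                Real.log I.numScenarios + r * Real.log I.Q) * I.OPT ∧
            1 - η ≤ I.coverProb B) := by
  classical
  constructor
  · refine ⟨48 / (1 / 2), by norm_num, ?_⟩
    intro U _ _ m I hfeas hind r η hr hη
    obtain ⟨A, hA, hOPT⟩ := I.exists_optimal hfeas
    -- The general bound needs n ≥ 1; for Q = 0 the empty set already covers.
    rcases Nat.eq_zero_or_pos I.Q with hQ | hQ
    · refine ⟨⟨fun _ _ => ∅⟩, ?_, ?_⟩
      · have h0 : I.setBasedCost (⟨fun _ _ => ∅⟩ : SetBasedSolution U m r) = 0 := by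
          simp [CoverInstance.setBasedCost, CoverInstance.expect, SetBasedSolution.roundSet,
            CoverInstance.setCost]
        rw [h0]
        have := I.OPT_nonneg hfeas
        positivity
      · have hcov : ∀ S X, I.Covers S X := fun S X =>
          le_antisymm (I.f_mono _ _ (Finset.subset_univ _)) (hQ ▸ Nat.zero_le _)
        simp only [CoverInstance.coverProb, CoverInstance.prob, CoverInstance.expect, hcov,
          if_true, mul_one, I.sum_toReal_D]
        linarith
    · exact I.exists_solution_of_makesProgress hOPT (by norm_num)
        (makesProgress_of_exchange (fun _ => ENNReal.toReal_nonneg) hind.exchange I.cost_nonneg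
          I.f I.f_mono I.f_submodular A fun X hX => hA X (I.toReal_D_ne_zero.1 hX))
        (fun S T X h => Nat.sub_le_sub_left (I.f_mono _ _ (Finset.image_subset_image h)) _)
        (fun S X Y h => by
          have : S.image X = S.image Y := Finset.image_congr h
          simp only [this])
        (fun S X _ h => le_antisymm (I.f_mono _ _ (Finset.subset_univ _))
          (Nat.sub_eq_zero_iff_le.1 h))
        hQ (fun X => Nat.sub_le _ _) hr hη
  · refine ⟨48 / (1 / 8), by norm_num, ?_⟩
    intro U _ _ m I hfeas r η hr hη
    obtain ⟨A, hA, hOPT⟩ := I.exists_optimal hfeas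
    have hsupp : I.D.support = ((Finset.univ.filter fun X => (I.D X).toReal ≠ 0 :
        Finset (Fin m → U)) : Set (Fin m → U)) := by
      ext X
      simp only [Finset.coe_filter, Finset.mem_univ, true_and, Set.mem_ofPred_eq,
        I.toReal_D_ne_zero]
    have hnum : I.numScenarios = (Finset.univ.filter fun X => (I.D X).toReal ≠ 0).card := by
      rw [CoverInstance.numScenarios, hsupp, Set.ncard_coe_finset]
    have hnum1 : 1 ≤ I.numScenarios := by
      rw [hnum, Nat.one_le_iff_ne_zero, Finset.card_ne_zero, ← Finset.coe_nonempty, ← hsupp]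
      exact I.D.support_nonempty
    obtain ⟨B, hB, hB'⟩ := I.exists_solution_of_makesProgress hOPT (κ := 1 / 8) (by norm_num)
      (makesProgress_scenario (cov := I.Covers) (fun _ => ENNReal.toReal_nonneg) I.cost_nonneg
        (fun S T X h hS => hS.mono h) A fun X hX => hA X (I.toReal_D_ne_zero.1 hX))
      (fun S T X h => scenarioRank_anti _ (fun S T X h hS => hS.mono h) h)
      (fun S X Y h => scenarioRank_congr _ (fun S X Y h hS => by
        have : S.image X = S.image Y := Finset.image_congr h
        rw [CoverInstance.Covers, ← this]
        exact hS) h)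
      (fun S X hX h => cov_of_scenarioRank_eq_zero
        (Finset.mem_filter.2 ⟨Finset.mem_univ _, I.toReal_D_ne_zero.2 hX⟩) h)
      hnum1 (fun X => by
        rw [hnum]
        exact scenarioRank_le_card _ _ _ X) hr hη
    refine ⟨B, hB.trans ?_, hB'⟩
    have hOPT0 := I.OPT_nonneg hfeas
    have hlogQ : 0 ≤ Real.log I.Q := Real.log_natCast_nonneg _
    gcongr
    -- The scenario argument gives the bound without the r log Q term, which is only added here as
    -- slack.
    exact le_add_of_nonneg_right (by positivity)
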